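/- Conventions. A topological groupoid $\mathcal G$ is a small category in which all morphisms are invertible, identified with its set of arrows and equipped with a topology for which the source map $\mathfrak s$, the range map $\mathfrak r$, the multiplication (on pairs $(g,h)$ with $\mathfrak s(g)=\mathfrak r(h)$) and the inversion are continuous; the objects are identified with their identity arrows, and the unit space $\mathcal G^{(0)}\subseteq\mathcal G$ carries the subspace topology. $\mathcal G$ is *étale* if $\mathfrak s,\mathfrak r\colon\mathcal G\to\mathcal G^{(0)}$ are local homeomorphisms; an étale groupoid is *ample* if $\mathcal G^{(0)}$ is totally disconnected, *minimal* if for every $x\in\mathcal G^{(0)}$ the orbit $\{\mathfrak r(g) : g\in\mathcal G,\ \mathfrak s(g)=x\}$ is dense in $\mathcal G^{(0)}$, and *effective* if the interior of $\{g\in\mathcal G : \mathfrak s(g)=\mathfrak r(g)\}$ is $\mathcal G^{(0)}$. A *global bisection* is a clopen set $U\subseteq\mathcal G$ such that $\mathfrak s|_U$ and $\mathfrak r|_U$ are homeomorphisms onto their images and $\mathfrak s(U)=\mathfrak r(U)=\mathcal G^{(0)}$. The *topological full group* $\bm F(\mathcal G)$ is the group of all global bisections, with $UV=\{gh : g\in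 U,\ h\in V,\ \mathfrak s(g)=\mathfrak r(h)\}$ and $U^{-1}=\{g^{-1} : g\in U\}$; its neutral element is $\mathcal G^{(0)}$. $\mathrm{Aut}(\mathcal G)$ denotes the group of groupoid automorphisms of $\mathcal G$ that are homeomorphisms. For $U\in\bm F(\mathcal G)$ let $\mathrm{Ad}(U)\in\mathrm{Aut}(\mathcal G)$ be given by $\mathrm{Ad}(U)(g)=u\,g\,v^{-1}$, where $u,v\in U$ are the unique elements with $\mathfrak s(u)=\mathfrak r(g)$ and $\mathfrak s(v)=\mathfrak s(g)$. The image $\mathrm{Inn}(\mathcal G)$ of the homomorphism $\mathrm{Ad}\colon\bm F(\mathcal G)\to\mathrm{Aut}(\mathcal G)$ is a normal subgroup, and $\mathrm{Out}(\mathcal G)=\mathrm{Aut}(\mathcal G)/\mathrm{Inn}(\mathcal G)$. For an abstract group $\Gamma$, $\mathrm{Out}(\Gamma)$ is the quotient of $\mathrm{Aut}(\Gamma)$ by the group of inner automorphisms. Each $\alpha\in\mathrm{Aut}(\mathcal G)$ induces $\alpha_{\bm F}\in\mathrm{Aut}(\bm F(\mathcal G))$ by $\alpha_{\bm F}(U)=\alpha(U)$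 (the image of the set $U$), and $\alpha\mapsto\alpha_{\bm F}$ is a group homomorphism $\mathrm{Aut}(\mathcal G)\to\mathrm{Aut}(\bm F(\mathcal G))$. **Proposition.** Let $\mathcal G$ be a second countable, locally compact, Hausdorff, ample, minimal and effective topological groupoid whose unit space $\mathcal G^{(0)}$ is homeomorphic to the Cantor set. Then: (i) the homomorphism $\mathrm{Aut}(\mathcal G)\to\mathrm{Aut}(\bm F(\mathcal G))$, $\alpha\mapsto\alpha_{\bm F}$, is an isomorphism; (ii) it descends to a group isomorphism $\mathrm{Out}(\mathcal G)\to\mathrm{Out}(\bm F(\mathcal G))$, that is, there is a group isomorphism that sends the class of $\alpha$ to the class of $\alpha_{\bm F}$ for every $\alpha\in\mathrm{Aut}(\mathcal G)$. -/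

import Mathlib

open Set Topology

set_option linter.unusedSectionVars false

universe u

/-- A (small) groupoid, presented by its set `G` of arrows, with the objects identified with
their identity arrows. `src` and `rng` are the source and range maps. The composition is written
as a total function, but only its values `comp g h` at composable pairs, that is, at pairs with
`src g = rng h`, have a meaning: no other value is constrained, or used, anywhere. -/
class ArrowGroupoid (G : Type u) where
  src : G → G
  rng : G → G
  comp : G → G → G
  inv : G → G
  src_src : ∀ g, src (src g) = src g
  rng_src : ∀ g, rng (src g) = src g
  src_rng : ∀ g, src (rng g) = rng g
  rng_rng : ∀ g, rng (rng g) = rng g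
  src_comp : ∀ g h, src g = rng h → src (comp g h) = src h
  rng_comp : ∀ g h, src g = rng h → rng (comp g h) = rng g
  comp_assoc : ∀ g h k, src g = rng h → src h = rng k →
    comp (comp g h) k = comp g (comp h k)
  comp_src : ∀ g, comp g (src g) = g
  rng_comp_self : ∀ g, comp (rng g) g = g
  src_inv : ∀ g, src (inv g) = rng g
  rng_inv : ∀ g, rng (inv g) = src g
  inv_comp : ∀ g, comp (inv g) g = src g
  comp_inv : ∀ g, comp g (inv g) = rng g

namespace ArrowGroupoid

attribute [simp] src_src rng_src src_rng rng_rng comp_src rng_comp_self src_inv rng_inv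
  inv_comp comp_inv

section Algebra

variable (G : Type u) [ArrowGroupoid G]

/-- The unit space: the set of identity arrows. It carries the subspace topology. -/
def unitSpace : Set G := {x | src x = x}

/-- The isotropy: the set of arrows whose source and range agree. -/
def isotropy : Set G := {g | src g = rng g}

variable {G}

/-- The source map with values in the unit space. -/
def srcUnit (g : G) : unitSpace G := ⟨src g, src_src g⟩

/-- The range map with values in the unit space. -/
def rngUnit (g : G) : unitSpace G := ⟨rng g, src_rng g⟩

theorem src_unit (x : unitSpace G) : src (x : G) = x := x.2

theorem rng_unit (x : unitSpace G) : rng (x : G) = x := by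
  have h := rng_src (x : G)
  rwa [src_unit] at h

theorem srcUnit_unit (x : unitSpace G) : srcUnit (x : G) = x := Subtype.ext (src_unit x)

theorem rngUnit_unit (x : unitSpace G) : rngUnit (x : G) = x := Subtype.ext (rng_unit x)

theorem eq_inv_of_comp {g h : G} (hc : src g = rng h) (e : comp g h = src h) : g = inv h := by
  have h1 : comp (comp g h) (inv h) = comp g (comp h (inv h)) :=
    comp_assoc g h (inv h) hc (by simp)
  rw [e, comp_inv, ← hc, comp_src, ← rng_inv, rng_comp_self] at h1
  exact h1.symm

theorem inv_inv' (g : G) : inv (inv g) = g :=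
  (eq_inv_of_comp (g := g) (h := inv g) (by simp) (by simp)).symm

theorem inv_comp_rev {g h : G} (hc : src g = rng h) :
    inv (comp g h) = comp (inv h) (inv g) := by
  symm
  have e1 : src (inv h) = rng (inv g) := by simp [hc]
  apply eq_inv_of_comp
  · rw [src_comp _ _ e1, rng_comp _ _ hc]; simp
  · rw [comp_assoc _ _ _ e1 (by rw [rng_comp _ _ hc]; simp), ← comp_assoc _ _ _ (by simp) hc,
      inv_comp, hc, rng_comp_self, inv_comp, src_comp _ _ hc]

/-- The product `U V = {g h | g ∈ U, h ∈ V, s(g) = r(h)}` of two sets of arrows. -/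
def setComp (U V : Set G) : Set G :=
  {k | ∃ g ∈ U, ∃ h ∈ V, src g = rng h ∧ comp g h = k}

/-- The inverse `U⁻¹ = {g⁻¹ | g ∈ U}` of a set of arrows. -/
def setInv (U : Set G) : Set G := inv '' U

theorem setComp_assoc (U V W : Set G) :
    setComp (setComp U V) W = setComp U (setComp V W) := by
  ext k
  constructor
  · rintro ⟨_, ⟨g, hg, h, hh, e, rfl⟩, l, hl, e', rfl⟩
    rw [src_comp _ _ e] at e'
    exact ⟨g, hg, comp h l, ⟨h, hh, l, hl, e', rfl⟩, by rw [rng_comp _ _ e', e],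
      (comp_assoc _ _ _ e e').symm⟩
  · rintro ⟨g, hg, _, ⟨h, hh, l, hl, e', rfl⟩, e, rfl⟩
    rw [rng_comp _ _ e'] at e
    exact ⟨comp g h, ⟨g, hg, h, hh, e, rfl⟩, l, hl, by rw [src_comp _ _ e, e'],
      comp_assoc _ _ _ e e'⟩

theorem unitSpace_setComp (U : Set G) : setComp (unitSpace G) U = U := by
  ext k
  constructor
  · rintro ⟨g, hg, h, hh, e, rfl⟩
    have : g = rng h := by rw [← e]; exact hg.symm
    rw [this, rng_comp_self]
    exact hh
  · intro hk
    exact ⟨rng k, src_rng k, k, hk, src_rng k, rng_comp_self k⟩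

end Algebra

section Topology

variable (G : Type u) [TopologicalSpace G] [ArrowGroupoid G]

/-- A topological groupoid: source, range, composition (on the space of composable pairs) and
inversion are continuous. -/
class IsTopologicalGroupoid : Prop where
  continuous_src : Continuous (src : G → G)
  continuous_rng : Continuous (rng : G → G)
  continuousOn_comp : ContinuousOn (fun p : G × G => comp p.1 p.2) {p | src p.1 = rng p.2}
  continuous_inv : Continuous (inv : G → G)

/-- An étale groupoid: source and range are local homeomorphisms onto the unit space. -/
class IsEtale : Prop extends IsTopologicalGroupoid G where
  isLocalHomeomorph_srcUnit : IsLocalHomeomorph (srcUnit : G → unitSpace G)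
  isLocalHomeomorph_rngUnit : IsLocalHomeomorph (rngUnit : G → unitSpace G)

/-- An ample groupoid: étale, with totally disconnected unit space. -/
class IsAmple : Prop extends IsEtale G where
  totallyDisconnectedSpace_unitSpace : TotallyDisconnectedSpace (unitSpace G)

/-- A minimal groupoid: every orbit `{r(g) | s(g) = x}` is dense in the unit space. -/
def IsMinimal : Prop :=
  ∀ x : unitSpace G, Dense {y : unitSpace G | ∃ g : G, srcUnit g = x ∧ rngUnit g = y}

/-- An effective (essentially principal) groupoid: the interior of the isotropy is the unit
space. -/
def IsEffective : Prop := interior (isotropy G) = unitSpace G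

variable {G}

/-- A bisection: a clopen set of arrows on which source and range are homeomorphisms onto their
images. -/
structure IsBisection (U : Set G) : Prop where
  isClopen : IsClopen U
  isEmbedding_src : IsEmbedding (fun g : U => srcUnit (g : G))
  isEmbedding_rng : IsEmbedding (fun g : U => rngUnit (g : G))

/-- A global bisection: a bisection `U` with `s(U) = r(U)` equal to the whole unit space. -/
structure IsGlobalBisection (U : Set G) : Prop extends IsBisection U where
  image_src : srcUnit '' U = univ
  image_rng : rngUnit '' U = univ

variable (G) in
/-- The topological full group, whose elements are the global bisections. -/
def FullGroup : Type u := {U : Set G // IsGlobalBisection U}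

namespace FullGroup

/-- The homeomorphism from a global bisection onto the unit space given by the source map. -/
noncomputable def srcHomeo (U : FullGroup G) : U.1 ≃ₜ unitSpace G :=
  U.2.isEmbedding_src.toHomeomorphOfSurjective (fun x => by
    obtain ⟨g, hg, e⟩ := (U.2.image_src.symm ▸ mem_univ x : x ∈ srcUnit '' U.1)
    exact ⟨⟨g, hg⟩, e⟩)

/-- The homeomorphism from a global bisection onto the unit space given by the range map. -/
noncomputable def rngHomeo (U : FullGroup G) : U.1 ≃ₜ unitSpace G :=
  U.2.isEmbedding_rng.toHomeomorphOfSurjective (fun x => by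
    obtain ⟨g, hg, e⟩ := (U.2.image_rng.symm ▸ mem_univ x : x ∈ rngUnit '' U.1)
    exact ⟨⟨g, hg⟩, e⟩)

/-- `U.sec x` is the unique arrow in `U` with source `x`. -/
noncomputable def sec (U : FullGroup G) (x : unitSpace G) : G := (U.srcHomeo.symm x : G)

/-- `U.rsec x` is the unique arrow in `U` with range `x`. -/
noncomputable def rsec (U : FullGroup G) (x : unitSpace G) : G := (U.rngHomeo.symm x : G)

/-- The homeomorphism `r ∘ (s|_U)⁻¹` of the unit space. -/
noncomputable def unitHomeo (U : FullGroup G) : unitSpace G ≃ₜ unitSpace G :=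
  U.srcHomeo.symm.trans U.rngHomeo

variable (U V : FullGroup G)

theorem sec_mem (x : unitSpace G) : U.sec x ∈ U.1 := (U.srcHomeo.symm x).2

theorem rsec_mem (x : unitSpace G) : U.rsec x ∈ U.1 := (U.rngHomeo.symm x).2

theorem srcUnit_sec (x : unitSpace G) : srcUnit (U.sec x) = x := U.srcHomeo.apply_symm_apply x

theorem rngUnit_rsec (x : unitSpace G) : rngUnit (U.rsec x) = x := U.rngHomeo.apply_symm_apply x

theorem src_sec (x : unitSpace G) : src (U.sec x) = x := congrArg Subtype.val (U.srcUnit_sec x)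

theorem rng_rsec (x : unitSpace G) : rng (U.rsec x) = x := congrArg Subtype.val (U.rngUnit_rsec x)

theorem sec_srcUnit {g : G} (hg : g ∈ U.1) : U.sec (srcUnit g) = g :=
  congrArg Subtype.val (U.srcHomeo.symm_apply_apply ⟨g, hg⟩)

theorem rsec_rngUnit {g : G} (hg : g ∈ U.1) : U.rsec (rngUnit g) = g :=
  congrArg Subtype.val (U.rngHomeo.symm_apply_apply ⟨g, hg⟩)

theorem rngUnit_sec (x : unitSpace G) : rngUnit (U.sec x) = U.unitHomeo x := rfl

theorem rng_sec (x : unitSpace G) : rng (U.sec x) = U.unitHomeo x := rfl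

theorem srcUnit_rsec (x : unitSpace G) : srcUnit (U.rsec x) = U.unitHomeo.symm x := rfl

theorem continuous_sec : Continuous U.sec := continuous_subtype_val.comp U.srcHomeo.symm.continuous

theorem continuous_rsec : Continuous U.rsec :=
  continuous_subtype_val.comp U.rngHomeo.symm.continuous

theorem sec_eq {g : G} {x : unitSpace G} (hg : g ∈ U.1) (e : srcUnit g = x) : U.sec x = g := by
  rw [← e, sec_srcUnit U hg]

end FullGroup

variable [IsEtale G]

theorem continuous_srcUnit : Continuous (srcUnit : G → unitSpace G) :=
  IsEtale.isLocalHomeomorph_srcUnit.continuous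

theorem continuous_rngUnit : Continuous (rngUnit : G → unitSpace G) :=
  IsEtale.isLocalHomeomorph_rngUnit.continuous

theorem continuous_comp {X : Type*} [TopologicalSpace X] {a b : X → G} (ha : Continuous a)
    (hb : Continuous b) (h : ∀ x, src (a x) = rng (b x)) :
    Continuous fun x => comp (a x) (b x) :=
  (IsTopologicalGroupoid.continuousOn_comp (G := G)).comp_continuous (ha.prodMk hb) h

/-- The range of a continuous section of the source map that the range map turns into a
homeomorphism of the unit space is a global bisection. -/
theorem isGlobalBisection_range [T2Space G] (σ : unitSpace G → G) (hσ : Continuous σ)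
    (hs : ∀ x, srcUnit (σ x) = x) (φ : unitSpace G ≃ₜ unitSpace G)
    (hr : ∀ x, rngUnit (σ x) = φ x) : IsGlobalBisection (range σ) := by
  have hcomp : (srcUnit : G → unitSpace G) ∘ σ = id := funext hs
  have hinv : ∀ g : range σ, σ (srcUnit (g : G)) = g := by
    rintro ⟨_, x, rfl⟩
    simp [hs]
  let e : range σ ≃ₜ unitSpace G :=
    { toFun := fun g => srcUnit (g : G)
      invFun := fun x => ⟨σ x, x, rfl⟩
      left_inv := fun g => Subtype.ext (hinv g)
      right_inv := fun x => hs x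
      continuous_toFun := continuous_srcUnit.comp continuous_subtype_val
      continuous_invFun := hσ.subtype_mk _ }
  refine ⟨⟨⟨?_, ?_⟩, e.isEmbedding, ?_⟩, ?_, ?_⟩
  · have : range σ = {g | σ (srcUnit g) = g} := by
      ext g
      exact ⟨fun hg => hinv ⟨g, hg⟩, fun hg => ⟨_, hg⟩⟩
    rw [this]
    exact isClosed_eq (hσ.comp continuous_srcUnit) continuous_id
  · refine (IsLocalHomeomorph.isOpenEmbedding_of_comp
      (IsEtale.isLocalHomeomorph_srcUnit (G := G)) ?_ hσ).isOpen_range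
    rw [hcomp]
    exact IsOpenEmbedding.id
  · have : (fun g : range σ => rngUnit (g : G)) = e.trans φ := by
      funext g
      rw [← hinv g, hr]
      rfl
    rw [this]
    exact (e.trans φ).isEmbedding
  · rw [← range_comp, hcomp, range_id]
  · rw [← range_comp]
    have : (rngUnit : G → unitSpace G) ∘ σ = φ := funext hr
    rw [this, φ.surjective.range_eq]

namespace FullGroup

variable [T2Space G] (U V : FullGroup G)

theorem comp_sec (x : unitSpace G) : src (U.sec (V.unitHomeo x)) = rng (V.sec x) := by
  rw [src_sec, rng_sec]

theorem isGlobalBisection_setComp : IsGlobalBisection (setComp U.1 V.1) := by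
  have e : setComp U.1 V.1 = range fun x => comp (U.sec (V.unitHomeo x)) (V.sec x) := by
    ext k
    constructor
    · rintro ⟨g, hg, h, hh, e, rfl⟩
      refine ⟨srcUnit h, ?_⟩
      have h1 : V.unitHomeo (srcUnit h) = srcUnit g := by
        rw [← rngUnit_sec, sec_srcUnit V hh]
        exact Subtype.ext e.symm
      simp only
      rw [h1, sec_srcUnit V hh, sec_srcUnit U hg]
    · rintro ⟨x, rfl⟩
      exact ⟨_, U.sec_mem _, _, V.sec_mem _, comp_sec U V x, rfl⟩
  rw [e]
  refine isGlobalBisection_range _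
    (continuous_comp (U.continuous_sec.comp V.unitHomeo.continuous) V.continuous_sec
      (comp_sec U V)) (fun x => ?_) (V.unitHomeo.trans U.unitHomeo) (fun x => ?_)
  · exact Subtype.ext ((src_comp _ _ (comp_sec U V x)).trans (V.src_sec x))
  · exact Subtype.ext (rng_comp _ _ (comp_sec U V x))

theorem isGlobalBisection_unitSpace : IsGlobalBisection (unitSpace G) := by
  have := isGlobalBisection_range (G := G) Subtype.val continuous_subtype_val srcUnit_unit
    (Homeomorph.refl _) rngUnit_unit
  rwa [Subtype.range_coe] at this

theorem isGlobalBisection_setInv : IsGlobalBisection (setInv U.1) := by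
  have e : setInv U.1 = range fun x => inv (U.rsec x) := by
    ext k
    constructor
    · rintro ⟨g, hg, rfl⟩
      exact ⟨rngUnit g, by simp only; rw [rsec_rngUnit U hg]⟩
    · rintro ⟨x, rfl⟩
      exact ⟨_, U.rsec_mem x, rfl⟩
  rw [e]
  refine isGlobalBisection_range _
    (IsTopologicalGroupoid.continuous_inv.comp U.continuous_rsec) (fun x => ?_)
    U.unitHomeo.symm (fun x => ?_)
  · exact Subtype.ext (by simp [srcUnit, rng_rsec])
  · rw [← srcUnit_rsec]
    exact Subtype.ext (by simp [srcUnit, rngUnit])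

/-- The group structure of the topological full group: product and inverse of global bisections
are those of sets of arrows, and the neutral element is the unit space. -/
instance : Group (FullGroup G) where
  mul U V := ⟨setComp U.1 V.1, isGlobalBisection_setComp U V⟩
  one := ⟨unitSpace G, isGlobalBisection_unitSpace⟩
  inv U := ⟨setInv U.1, isGlobalBisection_setInv U⟩
  mul_assoc U V W := Subtype.ext (setComp_assoc U.1 V.1 W.1)
  one_mul U := Subtype.ext (unitSpace_setComp U.1)
  mul_one U := Subtype.ext (by
    change setComp U.1 (unitSpace G) = U.1
    ext k
    constructor
    · rintro ⟨g, hg, h, hh, e, rfl⟩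
      rw [rng_unit ⟨h, hh⟩] at e
      change src g = h at e
      rw [← e, comp_src]
      exact hg
    · intro hk
      exact ⟨k, hk, src k, src_src k, (rng_src k).symm, comp_src k⟩)
  inv_mul_cancel U := Subtype.ext (by
    change setComp (setInv U.1) U.1 = unitSpace G
    ext k
    constructor
    · rintro ⟨_, ⟨g, hg, rfl⟩, h, hh, e, rfl⟩
      have e' : rngUnit g = rngUnit h := Subtype.ext ((src_inv g).symm.trans e)
      have : g = h := by rw [← rsec_rngUnit U hg, e', rsec_rngUnit U hh]
      subst this
      rw [inv_comp]
      exact src_src g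
    · intro hk
      refine ⟨_, ⟨_, U.sec_mem ⟨k, hk⟩, rfl⟩, _, U.sec_mem ⟨k, hk⟩, by simp, ?_⟩
      rw [inv_comp, src_sec])

theorem coe_mul : (U * V).1 = setComp U.1 V.1 := rfl

theorem coe_one : (1 : FullGroup G).1 = unitSpace G := rfl

theorem sec_mul (x : unitSpace G) :
    (U * V).sec x = comp (U.sec (V.unitHomeo x)) (V.sec x) := by
  refine sec_eq _ ⟨_, U.sec_mem _, _, V.sec_mem _, comp_sec U V x, rfl⟩ ?_
  exact Subtype.ext ((src_comp _ _ (comp_sec U V x)).trans (V.src_sec x))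

theorem sec_one (x : unitSpace G) : (1 : FullGroup G).sec x = x :=
  sec_eq _ x.2 (srcUnit_unit x)

end FullGroup

end Topology

section Aut

variable (G : Type u) [TopologicalSpace G] [ArrowGroupoid G]

/-- The group `Aut(G)` of homeomorphic groupoid automorphisms. -/
def autGroup : Subgroup (G ≃ₜ G) where
  carrier := {α | (∀ g, α (src g) = src (α g)) ∧ (∀ g, α (rng g) = rng (α g)) ∧
    ∀ g h, src g = rng h → α (comp g h) = comp (α g) (α h)}
  mul_mem' := by
    rintro α β ⟨a1, a2, a3⟩ ⟨b1, b2, b3⟩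
    refine ⟨fun g => ?_, fun g => ?_, fun g h e => ?_⟩
    · rw [Homeomorph.mul_apply, b1, a1, Homeomorph.mul_apply]
    · rw [Homeomorph.mul_apply, b2, a2, Homeomorph.mul_apply]
    · rw [Homeomorph.mul_apply, b3 g h e, a3 _ _ (by rw [← b1, ← b2, e])]
      rfl
  one_mem' := ⟨fun _ => rfl, fun _ => rfl, fun _ _ _ => rfl⟩
  inv_mem' := by
    rintro α ⟨a1, a2, a3⟩
    have b1 : ∀ g, α⁻¹ (src g) = src (α⁻¹ g) := fun g => by
      apply α.injective
      rw [a1, Homeomorph.inv_apply, Homeomorph.inv_apply, α.apply_symm_apply, α.apply_symm_apply]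
    have b2 : ∀ g, α⁻¹ (rng g) = rng (α⁻¹ g) := fun g => by
      apply α.injective
      rw [a2, Homeomorph.inv_apply, Homeomorph.inv_apply, α.apply_symm_apply, α.apply_symm_apply]
    refine ⟨b1, b2, fun g h e => ?_⟩
    apply α.injective
    rw [a3 _ _ (by rw [← b1, ← b2, e])]
    simp only [Homeomorph.inv_apply, α.apply_symm_apply]

variable {G}

theorem aut_src (α : autGroup G) (g : G) : α.1 (src g) = src (α.1 g) := α.2.1 g

theorem aut_rng (α : autGroup G) (g : G) : α.1 (rng g) = rng (α.1 g) := α.2.2.1 g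

theorem aut_comp (α : autGroup G) {g h : G} (e : src g = rng h) :
    α.1 (comp g h) = comp (α.1 g) (α.1 h) := α.2.2.2 g h e

theorem aut_inv (α : autGroup G) (g : G) : α.1 (inv g) = inv (α.1 g) := by
  apply eq_inv_of_comp
  · rw [← aut_src, ← aut_rng, src_inv]
  · rw [← aut_comp α (by simp), inv_comp, aut_src]

theorem aut_mem_unitSpace (α : autGroup G) (x : unitSpace G) : α.1 x ∈ unitSpace G :=
  (aut_src α x).symm.trans (congrArg α.1 (src_unit x))

/-- The homeomorphism of the unit space to which a groupoid automorphism restricts. -/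
def autUnit (α : autGroup G) : unitSpace G ≃ₜ unitSpace G where
  toFun x := ⟨α.1 x, aut_mem_unitSpace α x⟩
  invFun x := ⟨(α⁻¹).1 x, aut_mem_unitSpace α⁻¹ x⟩
  left_inv x := Subtype.ext (α.1.symm_apply_apply x)
  right_inv x := Subtype.ext (α.1.apply_symm_apply x)
  continuous_toFun := (α.1.continuous.comp continuous_subtype_val).subtype_mk _
  continuous_invFun := ((α⁻¹).1.continuous.comp continuous_subtype_val).subtype_mk _

variable [IsEtale G] [T2Space G]

theorem isGlobalBisection_image (α : autGroup G) (U : FullGroup G) :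
    IsGlobalBisection (α.1 '' U.1) := by
  have e : α.1 '' U.1 = range fun x => α.1 (U.sec ((autUnit α).symm x)) := by
    ext k
    constructor
    · rintro ⟨g, hg, rfl⟩
      refine ⟨autUnit α (srcUnit g), ?_⟩
      simp only
      rw [Homeomorph.symm_apply_apply, FullGroup.sec_srcUnit U hg]
    · rintro ⟨x, rfl⟩
      exact ⟨_, U.sec_mem _, rfl⟩
  rw [e]
  refine isGlobalBisection_range _ (α.1.continuous.comp (U.continuous_sec.comp
    (autUnit α).symm.continuous)) (fun x => ?_)
    (((autUnit α).symm.trans U.unitHomeo).trans (autUnit α)) (fun x => ?_)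
  · exact Subtype.ext ((aut_src α _).symm.trans ((congrArg α.1 (U.src_sec _)).trans
      (congrArg Subtype.val ((autUnit α).apply_symm_apply x))))
  · exact Subtype.ext (aut_rng α _).symm

theorem image_setComp (α : autGroup G) (U V : Set G) :
    α.1 '' setComp U V = setComp (α.1 '' U) (α.1 '' V) := by
  ext k
  constructor
  · rintro ⟨_, ⟨g, hg, h, hh, e, rfl⟩, rfl⟩
    exact ⟨_, ⟨g, hg, rfl⟩, _, ⟨h, hh, rfl⟩, by rw [← aut_src, ← aut_rng, e],
      (aut_comp α e).symm⟩
  · rintro ⟨_, ⟨g, hg, rfl⟩, _, ⟨h, hh, rfl⟩, e, rfl⟩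
    rw [← aut_src, ← aut_rng] at e
    have e' := α.1.injective e
    exact ⟨_, ⟨g, hg, h, hh, e', rfl⟩, aut_comp α e'⟩

variable (G) in
/-- The homomorphism `Aut(G) → Aut(F(G))` that sends `α` to the automorphism `U ↦ α(U)` of the
topological full group. -/
def autFull : autGroup G →* MulAut (FullGroup G) where
  toFun α :=
    { toFun := fun U => ⟨α.1 '' U.1, isGlobalBisection_image α U⟩
      invFun := fun U => ⟨(α⁻¹).1 '' U.1, isGlobalBisection_image α⁻¹ U⟩
      left_inv := fun U => Subtype.ext (by
        change (α⁻¹).1 '' (α.1 '' U.1) = U.1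
        rw [image_image]
        exact (image_congr fun g _ => α.1.symm_apply_apply g).trans (image_id' _))
      right_inv := fun U => Subtype.ext (by
        change α.1 '' ((α⁻¹).1 '' U.1) = U.1
        rw [image_image]
        exact (image_congr fun g _ => α.1.apply_symm_apply g).trans (image_id' _))
      map_mul' := fun U V => Subtype.ext (image_setComp α U.1 V.1) }
  map_one' := MulEquiv.ext fun U => Subtype.ext (image_id' U.1)
  map_mul' α β := MulEquiv.ext fun U => Subtype.ext (image_comp α.1 β.1 U.1)

/-- The map `g ↦ U g U⁻¹`: the composition `u g v⁻¹`, where `u` is the arrow in `U` with source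
`r(g)` and `v` is the arrow in `U` with source `s(g)`. -/
noncomputable def adFun (U : FullGroup G) (g : G) : G :=
  comp (comp (U.sec (rngUnit g)) g) (inv (U.sec (srcUnit g)))

theorem adFun_aux (U : FullGroup G) (g : G) : src (U.sec (rngUnit g)) = rng g := U.src_sec _

theorem adFun_aux' (U : FullGroup G) (g : G) :
    src (comp (U.sec (rngUnit g)) g) = rng (inv (U.sec (srcUnit g))) := by
  rw [src_comp _ _ (adFun_aux U g), rng_inv, U.src_sec]
  rfl

theorem src_adFun (U : FullGroup G) (g : G) : src (adFun U g) = U.unitHomeo (srcUnit g) := by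
  rw [adFun, src_comp _ _ (adFun_aux' U g), src_inv]
  rfl

theorem rng_adFun (U : FullGroup G) (g : G) : rng (adFun U g) = U.unitHomeo (rngUnit g) := by
  rw [adFun, rng_comp _ _ (adFun_aux' U g), rng_comp _ _ (adFun_aux U g)]
  rfl

theorem adFun_unit (U : FullGroup G) (x : unitSpace G) : adFun U (x : G) = U.unitHomeo x := by
  have h : src (U.sec x) = (x : G) := U.src_sec x
  rw [adFun, srcUnit_unit, rngUnit_unit]
  conv_lhs => rw [← h]
  rw [comp_src]
  have := comp_inv (U.sec x)
  rw [this]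
  rfl

theorem adFun_comp (U : FullGroup G) {g h : G} (e : src g = rng h) :
    adFun U (comp g h) = comp (adFun U g) (adFun U h) := by
  have e' : srcUnit g = rngUnit h := Subtype.ext e
  have e1 : rngUnit (comp g h) = rngUnit g := Subtype.ext (rng_comp _ _ e)
  have e2 : srcUnit (comp g h) = srcUnit h := Subtype.ext (src_comp _ _ e)
  have key : comp (adFun U g) (U.sec (rngUnit h)) = comp (U.sec (rngUnit g)) g := by
    rw [adFun, comp_assoc _ _ _ (adFun_aux' U g) (by rw [src_inv, e']), e', inv_comp,
      U.src_sec]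
    have := comp_src (comp (U.sec (rngUnit g)) g)
    rwa [src_comp _ _ (adFun_aux U g), e] at this
  have s1 : src (adFun U g) = rng (U.sec (rngUnit h)) := by rw [src_adFun, e']; rfl
  have s2 : src (adFun U g) = rng (comp (U.sec (rngUnit h)) h) := by
    rw [rng_comp _ _ (adFun_aux U h), s1]
  rw [adFun, e1, e2]
  conv_rhs => rw [adFun.eq_def U h, ← comp_assoc _ _ _ s2 (adFun_aux' U h),
    ← comp_assoc _ _ _ s1 (adFun_aux U h), key]
  rw [comp_assoc _ _ _ (adFun_aux U g) e]

theorem adFun_mul (U V : FullGroup G) (g : G) : adFun (U * V) g = adFun U (adFun V g) := by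
  have r1 : rngUnit (adFun V g) = V.unitHomeo (rngUnit g) := Subtype.ext (rng_adFun V g)
  have r2 : srcUnit (adFun V g) = V.unitHomeo (srcUnit g) := Subtype.ext (src_adFun V g)
  have c1 := FullGroup.comp_sec U V (rngUnit g)
  have c2 := FullGroup.comp_sec U V (srcUnit g)
  have c3 : src (U.sec (V.unitHomeo (rngUnit g))) = rng (comp (V.sec (rngUnit g)) g) := by
    rw [rng_comp _ _ (adFun_aux V g), c1]
  have c4 : src (inv (V.sec (srcUnit g))) = rng (inv (U.sec (V.unitHomeo (srcUnit g)))) := by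
    rw [src_inv, rng_inv, c2]
  have c5 := adFun_aux' V g
  rw [adFun, FullGroup.sec_mul, FullGroup.sec_mul, inv_comp_rev c2,
    comp_assoc _ _ _ c1 (adFun_aux V g), adFun.eq_def U, r1, r2, adFun.eq_def V]
  rw [← comp_assoc _ _ _ c3 c5]
  rw [comp_assoc _ _ _ (by rw [src_comp _ _ c3, c5]) c4]

theorem adFun_one (g : G) : adFun 1 g = g := by
  rw [adFun, FullGroup.sec_one, FullGroup.sec_one]
  have h : inv (src g) = src g := by
    have := eq_inv_of_comp (g := src g) (h := src g) (by simp)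
      (by have := comp_src (src g); simpa using this)
    exact this.symm
  change comp (comp (rng g) g) (inv (src g)) = g
  rw [h, rng_comp_self, comp_src]

theorem continuous_adFun (U : FullGroup G) : Continuous (adFun U) :=
  continuous_comp
    (continuous_comp (U.continuous_sec.comp continuous_rngUnit) continuous_id (adFun_aux U))
    (IsTopologicalGroupoid.continuous_inv.comp (U.continuous_sec.comp continuous_srcUnit))
    (adFun_aux' U)

variable (G) in
/-- The homomorphism `Ad : F(G) → Aut(G)`, `Ad(U)(g) = U g U⁻¹`. -/
noncomputable def Ad : FullGroup G →* autGroup G where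
  toFun U :=
    ⟨{ toFun := adFun U
       invFun := adFun U⁻¹
       left_inv := fun g => by rw [← adFun_mul, inv_mul_cancel, adFun_one]
       right_inv := fun g => by rw [← adFun_mul, mul_inv_cancel, adFun_one]
       continuous_toFun := continuous_adFun U
       continuous_invFun := continuous_adFun U⁻¹ },
      fun g => (adFun_unit U (srcUnit g)).trans (src_adFun U g).symm,
      fun g => (adFun_unit U (rngUnit g)).trans (rng_adFun U g).symm,
      fun _ _ e => adFun_comp U e⟩
  map_one' := Subtype.ext (Homeomorph.ext adFun_one)
  map_mul' U V := Subtype.ext (Homeomorph.ext (adFun_mul U V))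

theorem aut_adFun (α : autGroup G) (U : FullGroup G) (g : G) :
    α.1 (adFun U g) = adFun (autFull G α U) (α.1 g) := by
  have hsec : ∀ x, α.1 (U.sec x) = (autFull G α U).sec (autUnit α x) := fun x => by
    have hm : α.1 (U.sec x) ∈ (autFull G α U).1 := mem_image_of_mem _ (U.sec_mem x)
    refine (FullGroup.sec_eq _ hm ?_).symm
    exact Subtype.ext ((aut_src α _).symm.trans (congrArg α.1 (U.src_sec x)))
  have h1 : rngUnit (α.1 g) = autUnit α (rngUnit g) := Subtype.ext (aut_rng α g).symm
  have h2 : srcUnit (α.1 g) = autUnit α (srcUnit g) := Subtype.ext (aut_src α g).symm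
  rw [adFun, aut_comp α (adFun_aux' U g), aut_comp α (adFun_aux U g), aut_inv, hsec, hsec,
    adFun.eq_def (autFull G α U), h1, h2]

variable (G) in
/-- The group `Inn(G)` of inner automorphisms of a groupoid. -/
noncomputable def innGroup : Subgroup (autGroup G) := (Ad G).range

instance innGroup_normal : (innGroup G).Normal where
  conj_mem := by
    rintro _ ⟨U, rfl⟩ α
    refine ⟨autFull G α U, ?_⟩
    rw [eq_mul_inv_iff_mul_eq]
    exact Subtype.ext (Homeomorph.ext fun g => (aut_adFun α U g).symm)

variable (G) in
/-- The outer automorphism group `Out(G) = Aut(G) / Inn(G)` of a groupoid. -/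
abbrev OutGroupoid : Type u := autGroup G ⧸ innGroup G

end Aut

end ArrowGroupoid

/-- The group `Inn(Γ)` of inner automorphisms of an abstract group. -/
def innerAutomorphisms (Γ : Type u) [Group Γ] : Subgroup (MulAut Γ) :=
  (MulAut.conj : Γ →* MulAut Γ).range

instance innerAutomorphisms_normal (Γ : Type u) [Group Γ] : (innerAutomorphisms Γ).Normal where
  conj_mem := by
    rintro _ ⟨x, rfl⟩ α
    refine ⟨α x, ?_⟩
    ext y
    simp [MulAut.conj_apply]

/-- The outer automorphism group `Out(Γ) = Aut(Γ) / Inn(Γ)` of an abstract group. -/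
abbrev OutGroup (Γ : Type u) [Group Γ] : Type u := MulAut Γ ⧸ innerAutomorphisms Γ

open ArrowGroupoid

/-! The unit space can be recovered from the abstract group of global bisections, and effectiveness
then recovers the arrows. Effectiveness makes the action on the unit space faithful, so a bisection
may be studied through the set of points it moves. Minimality, together with the absence of isolated
points, supplies involutions with small support around every point.

The key is a purely group-theoretic description, for an involution `τ`, of those `k` whose moved set
lies in the closure of the moved set of `τ` (`mem_involutionHull_iff`). An automorphism `φ`
therefore respects such inclusions, and also disjointness of the moved sets of involutions
(`disjoint_movedSet_map`). A point `x` is encoded by the involutions that move it; by compactness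
the closures of the moved sets of their images under `φ` have a common point, which is unique. This
gives a homeomorphism `h` of the unit space that implements `φ` (`exists_equivariant_homeomorph`).

Every arrow lies in a global bisection (`exists_mem_fullGroup`). Two bisections have the same arrow
at `x` exactly when `x` is outside the closure of the set moved by `U⁻¹ * V`
(`closure_movedSet_eq`), a condition that `h` transports. Hence sending the arrow of `U` at `x` to
the arrow of `φ U` at `h x` is well defined and gives a groupoid automorphism inducing `φ`. For
injectivity, a groupoid automorphism that fixes every bisection acts equivariantly on units, hence
trivially. Finally `autFull_Ad` matches the inner automorphisms on both sides. -/

section Reconstruction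

/-! ### Recovering a space from a group acting on it -/

variable {Γ : Type*} {X : Type*} [Group Γ] [MulAction Γ X]

variable (X) in
/-- The set of points that a group element moves. -/
def movedSet (g : Γ) : Set X := {x | g • x ≠ x}

theorem mem_movedSet {g : Γ} {x : X} : x ∈ movedSet X g ↔ g • x ≠ x := Iff.rfl

theorem notMem_movedSet {g : Γ} {x : X} : x ∉ movedSet X g ↔ g • x = x := not_not

theorem smul_mem_movedSet {g : Γ} {x : X} (h : x ∈ movedSet X g) : g • x ∈ movedSet X g :=
  fun e => h (smul_left_cancel g e)

theorem mem_movedSet_conj {g t : Γ} {x : X} :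
    x ∈ movedSet X (g⁻¹ * t * g) ↔ g • x ∈ movedSet X t := by
  rw [mem_movedSet, mem_movedSet, mul_smul, mul_smul, not_iff_not, inv_smul_eq_iff]

theorem inv_smul_of_notMem_movedSet {g : Γ} {x : X} (h : x ∉ movedSet X g) : g⁻¹ • x = x := by
  rw [inv_smul_eq_iff, notMem_movedSet.1 h]

theorem smul_mem_movedSet_of_commute {g t : Γ} (h : Commute g t) {x : X}
    (hx : x ∈ movedSet X t) : g • x ∈ movedSet X t := fun e => hx (by
  apply smul_left_cancel g
  rw [← mul_smul, h.eq, mul_smul, e])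

theorem commute_of_disjoint_movedSet [FaithfulSMul Γ X] {g t : Γ}
    (h : Disjoint (movedSet X g) (movedSet X t)) : Commute g t := by
  refine eq_of_smul_eq_smul (α := X) fun x => ?_
  rw [mul_smul, mul_smul]
  by_cases hg : x ∈ movedSet X g
  · rw [notMem_movedSet.1 (disjoint_left.1 h hg),
      notMem_movedSet.1 (disjoint_left.1 h (smul_mem_movedSet hg))]
  · rw [notMem_movedSet.1 hg]
    by_cases ht : x ∈ movedSet X t
    · rw [notMem_movedSet.1 (disjoint_right.1 h (smul_mem_movedSet ht))]
    · rw [notMem_movedSet.1 ht, notMem_movedSet.1 hg]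

theorem movedSet_nonempty [FaithfulSMul Γ X] {g : Γ} (h : g ≠ 1) : (movedSet X g).Nonempty := by
  by_contra he
  refine h (eq_of_smul_eq_smul (α := X) fun x => ?_)
  rw [one_smul]
  by_contra hx
  exact he ⟨x, hx⟩

theorem isOpen_movedSet [TopologicalSpace X] [T2Space X] [ContinuousConstSMul Γ X] (g : Γ) :
    IsOpen (movedSet X g) := isOpen_ne_fun (continuous_const_smul g) continuous_id

/-- `σ` is an involution that commutes with `τ` and with all its conjugates under the
centralizer of `τ`. -/
def IsCentralInvolution (τ σ : Γ) : Prop :=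
  Commute σ τ ∧ σ * σ = 1 ∧ ∀ c, Commute c τ → Commute σ (c * σ * c⁻¹)

/-- The centralizer of the squares of the elements that commute with all the
`σ` with `IsCentralInvolution τ σ`. -/
def involutionHull (τ : Γ) : Set Γ :=
  {k | ∀ a, (∀ σ, IsCentralInvolution τ σ → Commute a σ) → Commute k (a * a)}

theorem IsCentralInvolution.map {Δ : Type*} [Group Δ] (φ : Γ ≃* Δ) {τ σ : Γ}
    (h : IsCentralInvolution τ σ) : IsCentralInvolution (φ τ) (φ σ) := by
  refine ⟨h.1.map φ, by rw [← map_mul, h.2.1, map_one], fun c hc => ?_⟩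
  have := (h.2.2 (φ.symm c) (by simpa using hc.map φ.symm)).map φ
  simpa using this

theorem mem_involutionHull_map {Δ : Type*} [Group Δ] (φ : Γ ≃* Δ) {τ k : Γ}
    (h : k ∈ involutionHull τ) : φ k ∈ involutionHull (φ τ) := by
  intro a ha
  have := (h (φ.symm a) fun σ hσ => by simpa using (ha _ (hσ.map φ)).map φ.symm).map φ
  simpa using this

variable [TopologicalSpace X]

variable (Γ X) in
/-- Conditions on a group action on a space that allow to recover the space from the group: there
are involutions with small support around every point, elements of order greater than two with
small support, an involution can be restricted to an invariant clopen set, and supports are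
open. -/
structure HasManyInvolutions : Prop where
  exists_involution : ∀ (x : X) (B : Set X), IsOpen B → x ∈ B →
    ∃ t : Γ, t * t = 1 ∧ x ∈ movedSet X t ∧ movedSet X t ⊆ B
  exists_mul_self_ne_one : ∀ B : Set X, IsOpen B → B.Nonempty →
    ∃ c : Γ, c * c ≠ 1 ∧ movedSet X c ⊆ B
  exists_restrict : ∀ t : Γ, t * t = 1 → ∀ A : Set X, IsClopen A → (∀ x ∈ A, t • x ∈ A) →
    ∃ s : Γ, (∀ x ∈ A, s • x = t • x) ∧ ∀ x ∉ A, s • x = x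
  isOpen_closure_movedSet : ∀ g : Γ, IsOpen (closure (movedSet X g))

/-- Fixed points separate points: some group element fixes `x` and moves any prescribed other point,
whereas `f x` must be fixed by whatever fixes `x`. -/
theorem eq_self_of_equivariant [T2Space X] (H : HasManyInvolutions Γ X) {f : X → X}
    (hf : ∀ (g : Γ) (x : X), f (g • x) = g • f x) (x : X) : f x = x := by
  by_contra hne
  obtain ⟨c, -, hc, hcB⟩ := H.exists_involution (f x) {x}ᶜ isClosed_singleton.isOpen_compl hne
  have hx : c • x = x := notMem_movedSet.1 fun h => hcB h rfl
  exact hc (by rw [← hf, hx])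

variable [ContinuousConstSMul Γ X] [FaithfulSMul Γ X] [T2Space X]

theorem exists_isOpen_disjoint_smul {g : Γ} {x : X} (h : g • x ≠ x) {O : Set X} (hO : IsOpen O)
    (hx : x ∈ O) : ∃ B ⊆ O, IsOpen B ∧ x ∈ B ∧ ∀ y ∈ B, g • y ∉ B := by
  obtain ⟨u, v, hu, hv, hgu, hxv, huv⟩ := t2_separation h
  refine ⟨O ∩ (v ∩ (g • ·) ⁻¹' u), inter_subset_left,
    hO.inter (hv.inter (hu.preimage (continuous_const_smul g))), ⟨hx, hxv, hgu⟩, ?_⟩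
  rintro y ⟨-, -, hy⟩ ⟨-, hy', -⟩
  exact disjoint_left.1 huv hy hy'

/-- If `σ` moved a point off the closure, some small open `B` there would be disjoint from its image
under `σ`. An element `d` supported in `B` commutes with `τ`, so `σ` commutes with `d * σ * d⁻¹`;
this forces `d * d = 1`. Elements with nontrivial square and small support rule that out. -/
theorem movedSet_subset_of_isCentralInvolution (H : HasManyInvolutions Γ X) {τ σ : Γ}
    (h : IsCentralInvolution τ σ) : movedSet X σ ⊆ closure (movedSet X τ) := by
  intro x hx
  by_contra hc
  obtain ⟨B, hBO, hB, hxB, hσB⟩ :=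
    exists_isOpen_disjoint_smul hx isClosed_closure.isOpen_compl hc
  obtain ⟨d, hd, hdB⟩ := H.exists_mul_self_ne_one B hB ⟨x, hxB⟩
  have hdτ : Commute d τ := commute_of_disjoint_movedSet (X := X)
    (disjoint_left.2 fun y hy hy' => hBO (hdB hy) (subset_closure hy'))
  have hcomm := h.2.2 d hdτ
  apply hd
  refine eq_of_smul_eq_smul (α := X) fun z => ?_
  rw [one_smul, mul_smul]
  by_cases hz : z ∈ movedSet X d
  · have e := congrArg (· • d • z) hcomm.eq
    have hσσ : ∀ y : X, σ • σ • y = y := fun y => by rw [← mul_smul, h.2.1, one_smul]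
    have hfix : ∀ y ∈ B, σ • y ∉ movedSet X d := fun y hy h' => hσB y hy (hdB h')
    simp only [mul_smul, inv_smul_smul] at e
    rw [notMem_movedSet.1 (hfix z (hdB hz)), hσσ,
      inv_smul_of_notMem_movedSet (hfix _ (hdB (smul_mem_movedSet hz))), hσσ] at e
    exact e.symm
  · rw [notMem_movedSet.1 hz, notMem_movedSet.1 hz]

/-- Conjugating by an element `c` of the centralizer of `τ` turns the restriction of `τ` to `A` into
its restriction to the translate of `A` by `c`, and any two restrictions of `τ` to invariant sets
commute. -/
theorem isCentralInvolution_restrict {τ s : Γ} (hτ : τ * τ = 1) {A : Set X}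
    (hA : ∀ x ∈ A, τ • x ∈ A) (h1 : ∀ x ∈ A, s • x = τ • x) (h2 : ∀ x ∉ A, s • x = x) :
    IsCentralInvolution τ s := by
  have hττ : ∀ y : X, τ • τ • y = y := fun y => by rw [← mul_smul, hτ, one_smul]
  have hA' : ∀ x, τ • x ∈ A ↔ x ∈ A := fun x => ⟨fun h => hττ x ▸ hA _ h, hA x⟩
  refine ⟨?_, ?_, fun c hc => ?_⟩
  · refine eq_of_smul_eq_smul (α := X) fun x => ?_
    rw [mul_smul, mul_smul]
    by_cases hx : x ∈ A
    · rw [h1 _ hx, h1 _ (hA _ hx)]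
    · rw [h2 _ hx, h2 _ (by rwa [hA'])]
  · refine eq_of_smul_eq_smul (α := X) fun x => ?_
    rw [mul_smul, one_smul]
    by_cases hx : x ∈ A
    · rw [h1 _ hx, h1 _ (hA _ hx), hττ]
    · rw [h2 _ hx, h2 _ hx]
  · have k1 : ∀ x, c⁻¹ • x ∈ A → (c * s * c⁻¹) • x = τ • x := fun x hx => by
      rw [mul_smul, mul_smul, h1 _ hx, ← mul_smul, hc.eq, mul_smul, smul_inv_smul]
    have k2 : ∀ x, c⁻¹ • x ∉ A → (c * s * c⁻¹) • x = x := fun x hx => by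
      rw [mul_smul, mul_smul, h2 _ hx, smul_inv_smul]
    have k3 : ∀ x, c⁻¹ • τ • x ∈ A ↔ c⁻¹ • x ∈ A := fun x => by
      rw [← mul_smul, hc.inv_left.eq, mul_smul, hA']
    refine eq_of_smul_eq_smul (α := X) fun x => ?_
    rw [mul_smul s, mul_smul _ s]
    by_cases hx : x ∈ A <;> by_cases hx' : c⁻¹ • x ∈ A
    · rw [k1 _ hx', h1 _ hx, h1 _ (hA _ hx), k1 _ ((k3 x).2 hx')]
    · rw [k2 _ hx', h1 _ hx, k2 _ (by rwa [k3])]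
    · rw [k1 _ hx', h2 _ hx, h2 _ (by rwa [hA']), k1 _ hx']
    · rw [k2 _ hx', h2 _ hx, k2 _ hx']

variable [CompactSpace X] [TotallyDisconnectedSpace X]

/-- Commuting with the restrictions of `τ` to arbitrarily small invariant clopen sets forces `a • y`
into the orbit `{y, τ • y}` of each moved point `y`. Either way `a * a` fixes `y`, because `a` also
commutes with `τ`. -/
theorem disjoint_movedSet_mul_self (H : HasManyInvolutions Γ X) {τ a : Γ} (hτ : τ * τ = 1)
    (ha : ∀ σ, IsCentralInvolution τ σ → Commute a σ) :
    Disjoint (closure (movedSet X τ)) (movedSet X (a * a)) := by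
  refine Disjoint.closure_left (disjoint_left.2 fun y hy hay => ?_) (isOpen_movedSet _)
  have hττ : ∀ y : X, τ • τ • y = y := fun y => by rw [← mul_smul, hτ, one_smul]
  have haτ : Commute a τ := ha τ (by
    refine ⟨.refl τ, hτ, fun c hc => ?_⟩
    rw [hc.eq, mul_inv_cancel_right])
  have h1 : a • y ≠ y := fun e => hay (by rw [mul_smul, e, e])
  have h2 : a • y ≠ τ • y := fun e => hay (by
    rw [mul_smul, e, ← mul_smul, haτ.eq, mul_smul, e, hττ])
  have h3 : τ • a • y ≠ y := fun e => h2 (by rw [← hττ (a • y), e])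
  -- Avoiding both `a • y` and its image under `τ` keeps `a • y` out of the invariant set generated
  -- by `C`.
  obtain ⟨C, hC, hyC, hCO⟩ := compact_exists_isClopen_in_isOpen
    (U := {a • y, τ • a • y}ᶜ) (toFinite _).isClosed.isOpen_compl (x := y) (by
      rintro (e | e)
      · exact h1 e.symm
      · exact h3 e.symm)
  obtain ⟨s, hs1, hs2⟩ := H.exists_restrict τ hτ (C ∪ (τ • ·) ⁻¹' C)
    (hC.union (hC.preimage (continuous_const_smul τ))) (by
      rintro x (hx | hx)
      · right; simpa [hττ] using hx
      · left; exact hx)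
  have hs := ha s (isCentralInvolution_restrict hτ (by
      rintro x (hx | hx)
      · right; simpa [hττ] using hx
      · left; exact hx) hs1 hs2)
  have hys : y ∈ movedSet X s := by
    rw [mem_movedSet, hs1 y (.inl hyC)]
    exact hy
  have := smul_mem_movedSet_of_commute hs hys
  refine this (hs2 _ ?_)
  rintro (h | h)
  · exact hCO h (.inl rfl)
  · exact hCO h (.inr rfl)

/-- The squares tested in the hull fix the closure pointwise, so they commute with everything
supported there. Conversely, every element supported off the closure commutes with all the `σ`, so
its square is among those tested; a `k` that moved a small open set there off itself could not
commute with a nontrivial square supported in that set. -/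
theorem mem_involutionHull_iff (H : HasManyInvolutions Γ X) {τ : Γ} (hτ : τ * τ = 1) {k : Γ} :
    k ∈ involutionHull τ ↔ movedSet X k ⊆ closure (movedSet X τ) := by
  refine ⟨fun hk x hx => ?_, fun hk a ha => ?_⟩
  · by_contra hc
    obtain ⟨B, hBO, hB, hxB, hkB⟩ :=
      exists_isOpen_disjoint_smul hx isClosed_closure.isOpen_compl hc
    obtain ⟨c, hc, hcB⟩ := H.exists_mul_self_ne_one B hB ⟨x, hxB⟩
    have hcc : movedSet X (c * c) ⊆ B := fun y hy => hcB fun e => hy (by rw [mul_smul, e, e])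
    have hcomm := hk c fun σ hσ => commute_of_disjoint_movedSet (X := X)
      (disjoint_left.2 fun y hy hy' =>
        hBO (hcB hy) (movedSet_subset_of_isCentralInvolution H hσ hy'))
    obtain ⟨y, hy⟩ := movedSet_nonempty (X := X) hc
    exact hkB y (hcc hy) (hcc (smul_mem_movedSet_of_commute hcomm hy))
  · exact commute_of_disjoint_movedSet (X := X)
      ((disjoint_movedSet_mul_self H hτ ha).mono_left hk)

theorem movedSet_map_subset (H : HasManyInvolutions Γ X) (φ : MulAut Γ) {k τ : Γ}
    (hτ : τ * τ = 1) (h : movedSet X k ⊆ closure (movedSet X τ)) :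
    movedSet X (φ k) ⊆ closure (movedSet X (φ τ)) := by
  rw [← mem_involutionHull_iff H (by rw [← map_mul, hτ, map_one])]
  exact mem_involutionHull_map φ ((mem_involutionHull_iff H hτ).2 h)

/-- An overlap of the images would contain the support of a nontrivial involution, whose preimage
would be supported in the closures of both original moved sets. -/
theorem disjoint_movedSet_map (H : HasManyInvolutions Γ X) (φ : MulAut Γ) {s t : Γ}
    (hs : s * s = 1) (ht : t * t = 1) (h : Disjoint (movedSet X s) (movedSet X t)) :
    Disjoint (movedSet X (φ s)) (movedSet X (φ t)) := by
  rw [disjoint_left]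
  intro y hys hyt
  obtain ⟨k, hk1, hyk, hk⟩ := H.exists_involution y _
    ((isOpen_movedSet (φ s)).inter (isOpen_movedSet (φ t))) ⟨hys, hyt⟩
  have key : ∀ r : Γ, r * r = 1 → movedSet X k ⊆ movedSet X (φ r) →
      movedSet X (φ.symm k) ⊆ closure (movedSet X r) := fun r hr hkr => by
    have := movedSet_map_subset H φ.symm (k := k) (τ := φ r) (by rw [← map_mul, hr, map_one])
      (hkr.trans subset_closure)
    rwa [MulEquiv.symm_apply_apply] at this
  have h1 := key s hs (hk.trans inter_subset_left)
  have h2 := key t ht (hk.trans inter_subset_right)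
  have hne : φ.symm k ≠ 1 := fun e => hyk (by
    have : k = 1 := by simpa using e
    rw [this, one_smul])
  obtain ⟨z, hz⟩ := movedSet_nonempty (X := X) hne
  -- Disjoint open sets have disjoint closures here because closures of moved sets are again open.
  have hcl := (h.closure_left (isOpen_movedSet t)).closure_right
    (H.isOpen_closure_movedSet s)
  exact disjoint_left.1 hcl (h1 hz) (h2 hz)

/-- The closed sets attached to the involutions moving `x` are directed downwards, since a smaller
involution fits into the intersection of two moved sets. Compactness then puts one of them inside
any open set that contains their intersection. The case of empty `O` gives existence of the image
point, general `O` its continuity. -/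
theorem exists_closure_movedSet_map_subset (H : HasManyInvolutions Γ X) (φ : MulAut Γ) (x : X)
    (O : Set X) (hO : IsOpen O)
    (hxO : ∀ y, (∀ t : Γ, t * t = 1 → x ∈ movedSet X t → y ∈ closure (movedSet X (φ t))) →
      y ∈ O) :
    ∃ t : Γ, t * t = 1 ∧ x ∈ movedSet X t ∧ closure (movedSet X (φ t)) ⊆ O := by
  let I := {t : Γ // t * t = 1 ∧ x ∈ movedSet X t}
  obtain ⟨t₀, h1, h2, -⟩ := H.exists_involution x univ isOpen_univ (mem_univ x)
  have : Nonempty I := ⟨⟨t₀, h1, h2⟩⟩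
  obtain ⟨⟨t, ht1, ht2⟩, ht⟩ := exists_subset_nhds_of_isCompact' (ι := I)
    (V := fun t => closure (movedSet X (φ t.1))) (fun s t => by
      obtain ⟨k, hk1, hxk, hk⟩ := H.exists_involution x _
        ((isOpen_movedSet s.1).inter (isOpen_movedSet t.1)) ⟨s.2.2, t.2.2⟩
      refine ⟨⟨k, hk1, hxk⟩, ?_, ?_⟩
      · exact closure_minimal (movedSet_map_subset H φ s.2.1
          (hk.trans (inter_subset_left.trans subset_closure))) isClosed_closure
      · exact closure_minimal (movedSet_map_subset H φ t.2.1
          (hk.trans (inter_subset_right.trans subset_closure))) isClosed_closure)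
    (fun t => isClosed_closure.isCompact) (fun t => isClosed_closure) (U := O)
    (fun y hy => hO.mem_nhds (hxO y fun t h1 h2 => mem_iInter.1 hy ⟨t, h1, h2⟩))
  exact ⟨t, ht1, ht2, ht⟩

theorem exists_reconstruct (H : HasManyInvolutions Γ X) (φ : MulAut Γ) (x : X) :
    ∃ y : X, ∀ t : Γ, t * t = 1 → x ∈ movedSet X t → y ∈ closure (movedSet X (φ t)) := by
  by_contra hc
  push Not at hc
  obtain ⟨t, ht1, ht2, ht⟩ := exists_closure_movedSet_map_subset H φ x ∅ isOpen_empty (fun y hy => by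
    obtain ⟨t, h1, h2, h3⟩ := hc y
    exact h3 (hy t h1 h2))
  have hne : φ t ≠ 1 := fun e => ht2 (by
    have : t = 1 := by simpa using e
    rw [this, one_smul])
  obtain ⟨z, hz⟩ := movedSet_nonempty (X := X) hne
  exact ht (subset_closure hz)

/-- Two candidates would be separated by involutions `c` and `d` with disjoint supports. The point
`x` would lie in the closure of the moved set of each preimage under `φ`, but those closures are
disjoint. -/
theorem reconstruct_unique (H : HasManyInvolutions Γ X) (φ : MulAut Γ) {x y z : X}
    (hy : ∀ t : Γ, t * t = 1 → x ∈ movedSet X t → y ∈ closure (movedSet X (φ t)))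
    (hz : ∀ t : Γ, t * t = 1 → x ∈ movedSet X t → z ∈ closure (movedSet X (φ t))) : y = z := by
  by_contra hne
  obtain ⟨u, v, hu, hv, hyu, hzv, huv⟩ := t2_separation hne
  obtain ⟨c, hc1, hyc, hc⟩ := H.exists_involution y u hu hyu
  obtain ⟨d, hd1, hzd, hd⟩ := H.exists_involution z v hv hzv
  have key : ∀ (c : Γ) (y : X), c * c = 1 → y ∈ movedSet X c →
      (∀ t : Γ, t * t = 1 → x ∈ movedSet X t → y ∈ closure (movedSet X (φ t))) →
      x ∈ closure (movedSet X (φ.symm c)) := by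
    -- Otherwise an involution `k` at `x` has moved set disjoint from that of `φ.symm c`; applying
    -- `φ` keeps `y` away from the closure of the set moved by `φ k`.
    intro c y hc hyc hy
    by_contra hx
    obtain ⟨k, hk1, hxk, hk⟩ := H.exists_involution x _ isClosed_closure.isOpen_compl hx
    have hdis := disjoint_movedSet_map H φ hk1 (t := φ.symm c)
      (by rw [← map_mul, hc, map_one])
      (disjoint_left.2 fun w hw hw' => hk hw (subset_closure hw'))
    rw [MulEquiv.apply_symm_apply] at hdis
    exact disjoint_left.1 (hdis.closure_left (isOpen_movedSet c)) (hy k hk1 hxk) hyc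
  have hdis := disjoint_movedSet_map H φ.symm hc1 hd1 (huv.mono hc hd)
  have hcl := (hdis.closure_left (isOpen_movedSet _)).closure_right
    (H.isOpen_closure_movedSet _)
  exact disjoint_left.1 hcl (key c y hc1 hyc hy) (key d z hd1 hzd hz)

theorem exists_equivariant_map (H : HasManyInvolutions Γ X) (φ : MulAut Γ) :
    ∃ h : X → X, Continuous h ∧ ∀ (g : Γ) (x : X), h (g • x) = φ g • h x := by
  choose h hh using exists_reconstruct H φ
  refine ⟨h, continuous_iff_continuousAt.2 fun x => ?_, fun g x => ?_⟩
  · rw [ContinuousAt, tendsto_nhds]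
    intro O hO hx
    obtain ⟨t, ht1, ht2, ht⟩ := exists_closure_movedSet_map_subset H φ x O hO
      (fun y hy => by rwa [reconstruct_unique H φ hy (hh x)])
    filter_upwards [(isOpen_movedSet t).mem_nhds ht2] with w hw
    exact ht (hh w t ht1 hw)
  · refine reconstruct_unique H φ (hh (g • x)) fun t ht1 ht2 => ?_
    -- An involution moving `g • x` is conjugated to one moving `x`, so `φ g • h x` satisfies the
    -- conditions that determine `h (g • x)`.
    have := hh x (g⁻¹ * t * g) (by
      calc g⁻¹ * t * g * (g⁻¹ * t * g) = g⁻¹ * (t * t) * g := by group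
        _ = 1 := by rw [ht1]; group) (mem_movedSet_conj.2 ht2)
    have hmap : MapsTo (φ g • · : X → X) (movedSet X (φ (g⁻¹ * t * g))) (movedSet X (φ t)) := by
      intro w hw
      rw [map_mul, map_mul, map_inv, mem_movedSet_conj] at hw
      exact hw
    exact hmap.closure (continuous_const_smul _) this

/-- Every automorphism of a group with many involutions is implemented by a homeomorphism. -/
theorem exists_equivariant_homeomorph (H : HasManyInvolutions Γ X) (φ : MulAut Γ) :
    ∃ h : X ≃ₜ X, ∀ (g : Γ) (x : X), h (g • x) = φ g • h x := by
  obtain ⟨h, hc, hh⟩ := exists_equivariant_map H φ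
  obtain ⟨k, kc, hk⟩ := exists_equivariant_map H φ.symm
  refine ⟨⟨⟨h, k, fun x => ?_, fun x => ?_⟩, hc, kc⟩, hh⟩
  -- Both composites commute with the action, hence are the identity.
  · exact eq_self_of_equivariant H (f := fun x => k (h x))
      (fun g x => by rw [hh, hk, MulEquiv.symm_apply_apply]) x
  · exact eq_self_of_equivariant H (f := fun x => h (k x))
      (fun g x => by rw [hk, hh, MulEquiv.apply_symm_apply]) x

end Reconstruction

/-! ### Absence of isolated points -/

theorem not_isOpen_singleton_of_homeomorph_cantorSet {X : Type*} [TopologicalSpace X]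
    (e : X ≃ₜ cantorSet) (x : X) : ¬ IsOpen ({x} : Set X) := by
  intro h
  let e' := e.trans cantorSetHomeomorphNatToBool
  have h' : IsOpen ({e' x} : Set (ℕ → Bool)) := by
    rw [← image_singleton]
    exact e'.isOpenMap _ h
  -- Flipping the `n`-th bit gives points different from `e' x` that converge to it.
  have ht : Filter.Tendsto (fun n => Function.update (e' x) n (!(e' x n))) Filter.atTop
      (𝓝 (e' x)) := by
    rw [tendsto_pi_nhds]
    intro k
    refine tendsto_const_nhds.congr' ?_
    filter_upwards [Filter.eventually_gt_atTop k] with n hn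
    rw [Function.update_of_ne hn.ne]
  obtain ⟨n, hn⟩ := (ht.eventually (h'.mem_nhds rfl)).exists
  have := congrFun hn n
  simp at this

/-! ### The full group acting on the unit space -/

namespace ArrowGroupoid

variable {G : Type u} [TopologicalSpace G] [ArrowGroupoid G] [IsEtale G] [T2Space G]

namespace FullGroup

noncomputable instance : MulAction (FullGroup G) (unitSpace G) where
  smul U x := U.unitHomeo x
  one_smul x := by
    change (1 : FullGroup G).unitHomeo x = x
    rw [← rngUnit_sec, sec_one, rngUnit_unit]
  mul_smul U V x := by
    change (U * V).unitHomeo x = U.unitHomeo (V.unitHomeo x)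
    rw [← rngUnit_sec, ← rngUnit_sec U, sec_mul]
    exact Subtype.ext (rng_comp _ _ (comp_sec U V x))

theorem rngUnit_sec' (U : FullGroup G) (x : unitSpace G) : rngUnit (U.sec x) = U • x := rfl

instance : ContinuousConstSMul (FullGroup G) (unitSpace G) where
  continuous_const_smul U := U.unitHomeo.continuous

theorem sec_mul' (U V : FullGroup G) (x : unitSpace G) :
    (U * V).sec x = comp (U.sec (V • x)) (V.sec x) := sec_mul U V x

theorem ext_sec {U V : FullGroup G} (h : ∀ x, U.sec x = V.sec x) : U = V := by
  have key : ∀ W : FullGroup G, W.1 = range W.sec := fun W =>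
    Subset.antisymm (fun g hg => ⟨_, sec_srcUnit W hg⟩) (range_subset_iff.2 W.sec_mem)
  exact Subtype.ext (by rw [key U, key V, funext h])

/-- The element of the full group whose arrow at `x` is `σ x`. -/
theorem exists_sec_eq (σ : unitSpace G → G) (hσ : Continuous σ) (hs : ∀ x, srcUnit (σ x) = x)
    (φ : unitSpace G ≃ₜ unitSpace G) (hr : ∀ x, rngUnit (σ x) = φ x) :
    ∃ U : FullGroup G, (∀ x, U.sec x = σ x) ∧ ∀ x, U • x = φ x := by
  have key : ∀ x, sec ⟨range σ, isGlobalBisection_range σ hσ hs φ hr⟩ x = σ x :=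
    fun x => sec_eq _ (mem_range_self x) (hs x)
  exact ⟨⟨range σ, isGlobalBisection_range σ hσ hs φ hr⟩, key,
    fun x => (congrArg rngUnit (key x)).trans (hr x)⟩

theorem smul_eq_of_sec_eq {U : FullGroup G} {x : unitSpace G} (h : U.sec x = x) : U • x = x := by
  rw [← rngUnit_sec', h, rngUnit_unit]

theorem isClosed_sec_eq (U : FullGroup G) : IsClosed {x | U.sec x = (x : G)} :=
  isClosed_eq U.continuous_sec continuous_subtype_val

theorem mul_self_eq_one_of_sec {U : FullGroup G}
    (h : ∀ x, comp (U.sec (U • x)) (U.sec x) = x) : U * U = 1 :=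
  ext_sec fun x => by rw [sec_mul', h, sec_one]

/-- This reduces agreement of two bisections at a point to triviality of a single one, which
`closure_movedSet_eq` expresses through moved points. -/
theorem sec_inv_mul_eq_iff (U V : FullGroup G) (x : unitSpace G) :
    (U⁻¹ * V).sec x = x ↔ U.sec x = V.sec x := by
  constructor
  · intro h
    have h1 : V.sec x = (U * (U⁻¹ * V)).sec x := by rw [mul_inv_cancel_left]
    rw [h1, sec_mul', smul_eq_of_sec_eq h, h]
    conv_lhs => rw [← comp_src (U.sec x), src_sec]
  · intro h
    have hUV : U • x = V • x := by rw [← rngUnit_sec', h, rngUnit_sec']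
    have h1 : (U⁻¹ * U).sec x = x := by rw [inv_mul_cancel, sec_one]
    rw [sec_mul'] at h1 ⊢
    rw [← hUV, ← h, h1]

end FullGroup

/-! ### Effectiveness, minimality and the supply of involutions -/

open FullGroup

theorem isOpen_unitSpace : IsOpen (unitSpace G) :=
  (isGlobalBisection_unitSpace (G := G)).isClopen.2

theorem isOpen_sec_eq (U : FullGroup G) : IsOpen {x | U.sec x = (x : G)} := by
  have : {x | U.sec x = (x : G)} = U.sec ⁻¹' unitSpace G := by
    ext x
    refine ⟨fun h => ?_, fun h => ?_⟩
    · rw [mem_preimage, show U.sec x = x from h]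
      exact x.2
    · exact (show src (U.sec x) = U.sec x from h).symm.trans (U.src_sec x)
  rw [this]
  exact isOpen_unitSpace.preimage U.continuous_sec

/-- Over the complement of the closure, `U` consists of isotropy arrows and is open, so
effectiveness makes them units. Conversely, the points with trivial arrow form an open set of fixed
points, because the unit space is open in an étale groupoid. -/
theorem closure_movedSet_eq (heff : IsEffective G) (U : FullGroup G) :
    closure (movedSet (unitSpace G) U) = {x | U.sec x = (x : G)}ᶜ := by
  refine Subset.antisymm (closure_minimal (fun x hx h => hx (smul_eq_of_sec_eq h))
    (isOpen_sec_eq U).isClosed_compl) fun x hx => ?_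
  by_contra hc
  apply hx
  let O : Set G := U.1 ∩ srcUnit ⁻¹' (closure (movedSet (unitSpace G) U))ᶜ
  have hO : IsOpen O := U.2.isClopen.2.inter
    (isClosed_closure.isOpen_compl.preimage continuous_srcUnit)
  have hOi : O ⊆ isotropy G := by
    rintro g ⟨hg, hgc⟩
    have h1 : U • srcUnit g = srcUnit g :=
      notMem_movedSet.1 fun h => hgc (subset_closure h)
    rw [← rngUnit_sec', sec_srcUnit U hg] at h1
    exact congrArg Subtype.val h1.symm
  have hmem : U.sec x ∈ O := ⟨U.sec_mem x, by rwa [mem_preimage, srcUnit_sec]⟩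
  have hu : U.sec x ∈ unitSpace G := by
    rw [← show interior (isotropy G) = unitSpace G from heff]
    exact interior_maximal hOi hO hmem
  exact (show src (U.sec x) = U.sec x from hu).symm.trans (U.src_sec x)

theorem faithfulSMul_fullGroup (heff : IsEffective G) :
    FaithfulSMul (FullGroup G) (unitSpace G) where
  eq_of_smul_eq_smul {U V} h := by
    refine ext_sec fun x => (sec_inv_mul_eq_iff U V x).1 ?_
    by_contra hx
    have hm : movedSet (unitSpace G) (U⁻¹ * V) = ∅ := by
      ext y
      simp [mem_movedSet, mul_smul, ← h]
    have hx' : x ∈ closure (movedSet (unitSpace G) (U⁻¹ * V)) := by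
      rw [closure_movedSet_eq heff]
      exact hx
    rw [hm, closure_empty] at hx'
    exact hx'

/-- An element of the full group can be restricted to an invariant clopen set. -/
theorem exists_restrict (U : FullGroup G) {A : Set (unitSpace G)} (hA : IsClopen A)
    (h1 : ∀ x, U • x ∈ A ↔ x ∈ A) :
    ∃ V : FullGroup G, (∀ x ∈ A, V • x = U • x) ∧ ∀ x ∉ A, V • x = x := by
  classical
  have hc : ∀ {Z : Type u} [TopologicalSpace Z] {a b : unitSpace G → Z}, Continuous a →
      Continuous b → Continuous fun x => if x ∈ A then a x else b x := fun ha hb =>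
    ha.if (fun x hx => by rw [show {x | x ∈ A} = A from rfl, hA.frontier_eq] at hx; exact hx.elim)
      hb
  have h2 : ∀ x, U⁻¹ • x ∈ A ↔ x ∈ A := fun x => by rw [← h1, smul_inv_smul]
  let φ : unitSpace G ≃ₜ unitSpace G :=
    { toFun := fun x => if x ∈ A then U • x else x
      invFun := fun x => if x ∈ A then U⁻¹ • x else x
      left_inv := fun x => by by_cases hx : x ∈ A <;> simp [hx, h1]
      right_inv := fun x => by by_cases hx : x ∈ A <;> simp [hx, h2]
      continuous_toFun := hc (continuous_const_smul U) continuous_id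
      continuous_invFun := hc (continuous_const_smul U⁻¹) continuous_id }
  obtain ⟨V, -, hV⟩ := exists_sec_eq (fun x => if x ∈ A then U.sec x else (x : G))
    (hc U.continuous_sec continuous_subtype_val)
    (fun x => by
      by_cases hx : x ∈ A
      · simp only [if_pos hx, srcUnit_sec]
      · simp only [if_neg hx, srcUnit_unit])
    φ (fun x => by
      change _ = if x ∈ A then U • x else x
      by_cases hx : x ∈ A
      · simp only [if_pos hx, rngUnit_sec']
      · simp only [if_neg hx, rngUnit_unit])
  refine ⟨V, fun x hx => (hV x).trans (if_pos hx), fun x hx => (hV x).trans (if_neg hx)⟩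

/-- An arrow between distinct units is contained in a global bisection of order two that is
trivial outside a given neighbourhood of its source and range. -/
theorem exists_involution_mem [CompactSpace (unitSpace G)]
    [TotallyDisconnectedSpace (unitSpace G)] (g : G) (hg : srcUnit g ≠ rngUnit g)
    {B : Set (unitSpace G)} (hB : IsOpen B) (hs : srcUnit g ∈ B) (hr : rngUnit g ∈ B) :
    ∃ U : FullGroup G, U * U = 1 ∧ g ∈ U.1 ∧ movedSet (unitSpace G) U ⊆ B := by
  classical
  obtain ⟨e, hge, he⟩ := IsEtale.isLocalHomeomorph_srcUnit g
  obtain ⟨f, hgf, hf⟩ := IsEtale.isLocalHomeomorph_rngUnit g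
  obtain ⟨u, v, hu, hv, hgu, hgv, huv⟩ := t2_separation hg
  -- On `N` both source and range are injective with local inverses, and the images of `N` under
  -- them are disjoint subsets of `B`.
  let N : Set G := (e.source ∩ f.source) ∩ (srcUnit ⁻¹' (u ∩ B) ∩ rngUnit ⁻¹' (v ∩ B))
  have hN : IsOpen N := (e.open_source.inter f.open_source).inter
    (((hu.inter hB).preimage continuous_srcUnit).inter ((hv.inter hB).preimage continuous_rngUnit))
  have hgN : g ∈ N := ⟨⟨hge, hgf⟩, ⟨hgu, hs⟩, hgv, hr⟩
  obtain ⟨A, hA, hgA, hAN⟩ := compact_exists_isClopen_in_isOpen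
    (IsEtale.isLocalHomeomorph_srcUnit.isOpenMap _ hN) (mem_image_of_mem srcUnit hgN)
  have hes : ∀ y, e y = srcUnit y := fun y => (congrFun he y).symm
  have hfr : ∀ y, f y = rngUnit y := fun y => (congrFun hf y).symm
  let σ : unitSpace G → G := e.symm
  let ρ : unitSpace G → G := f.symm
  have hσs : ∀ y ∈ N, σ (srcUnit y) = y := fun y hy => by
    rw [← hes]; exact e.left_inv hy.1.1
  have hρr : ∀ y ∈ N, ρ (rngUnit y) = y := fun y hy => by
    rw [← hfr]; exact f.left_inv hy.1.2
  have hσN : ∀ x ∈ A, σ x ∈ N ∧ srcUnit (σ x) = x := fun x hx => by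
    obtain ⟨y, hy, rfl⟩ := hAN hx
    rw [hσs y hy]
    exact ⟨hy, rfl⟩
  have hσc : ContinuousOn σ A := e.continuousOn_symm.mono fun x hx => by
    obtain ⟨y, hy, rfl⟩ := hAN hx
    rw [← hes]
    exact e.map_source hy.1.1
  let W : Set G := N ∩ srcUnit ⁻¹' A
  have hW : IsOpen W := hN.inter (hA.2.preimage continuous_srcUnit)
  let A' : Set (unitSpace G) := rngUnit '' W
  have hA'σ : A' = (fun x => rngUnit (σ x)) '' A := by
    ext x
    constructor
    · rintro ⟨y, ⟨hy, hyA⟩, rfl⟩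
      exact ⟨srcUnit y, hyA, by simp only [hσs y hy]⟩
    · rintro ⟨x, hx, rfl⟩
      exact ⟨σ x, ⟨(hσN x hx).1, by rw [mem_preimage, (hσN x hx).2]; exact hx⟩, rfl⟩
  have hA' : IsClopen A' := by
    refine ⟨?_, IsEtale.isLocalHomeomorph_rngUnit.isOpenMap _ hW⟩
    rw [hA'σ]
    exact (hA.1.isCompact.image_of_continuousOn
      (continuous_rngUnit.comp_continuousOn hσc)).isClosed
  have hρW : ∀ x ∈ A', ρ x ∈ W ∧ rngUnit (ρ x) = x := by
    rintro _ ⟨y, hy, rfl⟩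
    rw [hρr y hy.1]
    exact ⟨hy, rfl⟩
  have hρc : ContinuousOn ρ A' := f.continuousOn_symm.mono fun x hx => by
    obtain ⟨y, hy, rfl⟩ := hx
    rw [← hfr]
    exact f.map_source hy.1.1.2
  have hAA' : ∀ x ∈ A, x ∉ A' := by
    rintro x hx ⟨y, hy, rfl⟩
    have h1 := (hσN _ hx)
    have h2 : rngUnit y ∈ u := by
      rw [← h1.2]
      exact h1.1.2.1.1
    exact disjoint_left.1 huv h2 hy.1.2.2.1
  -- The bisection consists of `W`, the inverses of its arrows, and the units outside `A` and `A'`;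
  -- it exchanges these two disjoint clopen sets.
  let τ : unitSpace G → G := fun x => if x ∈ A then σ x else if x ∈ A' then inv (ρ x) else x
  have hτ1 : ∀ x ∈ A, τ x = σ x := fun x hx => if_pos hx
  have hτ2 : ∀ x ∈ A', τ x = inv (ρ x) := fun x hx => by
    have : x ∉ A := fun h => hAA' x h hx
    simp only [τ, if_neg this, if_pos hx]
  have hτ3 : ∀ x, x ∉ A → x ∉ A' → τ x = x := fun x h1 h2 => by
    simp only [τ, if_neg h1, if_neg h2]
  have hτc : Continuous τ := by
    rw [continuous_iff_continuousAt]
    intro x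
    by_cases hx : x ∈ A
    · exact (hσc.continuousAt (hA.2.mem_nhds hx)).congr
        (by filter_upwards [hA.2.mem_nhds hx] with y hy using (hτ1 y hy).symm)
    by_cases hx' : x ∈ A'
    · exact ((IsTopologicalGroupoid.continuous_inv.comp_continuousOn hρc).continuousAt
        (hA'.2.mem_nhds hx')).congr
        (by filter_upwards [hA'.2.mem_nhds hx'] with y hy using (hτ2 y hy).symm)
    · exact continuous_subtype_val.continuousAt.congr
        (by filter_upwards [hA.1.isOpen_compl.mem_nhds hx, hA'.1.isOpen_compl.mem_nhds hx']
              with y h1 h2 using (hτ3 y h1 h2).symm)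
  have hτs : ∀ x, srcUnit (τ x) = x := fun x => by
    by_cases hx : x ∈ A
    · rw [hτ1 x hx, (hσN x hx).2]
    by_cases hx' : x ∈ A'
    · rw [hτ2 x hx']
      exact Subtype.ext ((src_inv _).trans (congrArg Subtype.val (hρW x hx').2))
    · rw [hτ3 x hx hx', srcUnit_unit]
  have hτi : ∀ x, τ (rngUnit (τ x)) = inv (τ x) := fun x => by
    by_cases hx : x ∈ A
    · have hm : rngUnit (σ x) ∈ A' := hA'σ ▸ mem_image_of_mem _ hx
      rw [hτ1 x hx, hτ2 _ hm, hρr _ (hσN x hx).1]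
    by_cases hx' : x ∈ A'
    · have h1 : rngUnit (inv (ρ x)) = srcUnit (ρ x) := Subtype.ext (rng_inv _)
      rw [hτ2 x hx', h1, hτ1 _ (hρW x hx').1.2, hσs _ (hρW x hx').1.1, inv_inv']
    · rw [hτ3 x hx hx', rngUnit_unit, hτ3 x hx hx']
      apply eq_inv_of_comp
      · rw [src_unit, rng_unit]
      · conv_lhs => enter [1]; rw [← rng_unit x]
        rw [rng_comp_self, src_unit]
  have hinv : Function.Involutive fun x => rngUnit (τ x) := fun x => by
    simp only [hτi]
    rw [show rngUnit (inv (τ x)) = srcUnit (τ x) from Subtype.ext (rng_inv _), hτs]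
  obtain ⟨U, hU, hUs⟩ := exists_sec_eq τ hτc hτs
    ⟨hinv.toPerm, continuous_rngUnit.comp hτc, continuous_rngUnit.comp hτc⟩ (fun x => rfl)
  refine ⟨U, mul_self_eq_one_of_sec fun x => ?_, ?_, fun x hx => ?_⟩
  · rw [hU, hU, show U • x = rngUnit (τ x) from hUs x, hτi, inv_comp]
    exact congrArg Subtype.val (hτs x)
  · have := U.sec_mem (srcUnit g)
    rwa [hU, hτ1 _ hgA, hσs _ hgN] at this
  · rw [mem_movedSet, ← rngUnit_sec', hU] at hx
    by_cases hxA : x ∈ A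
    · rw [← (hσN x hxA).2]
      exact (hσN x hxA).1.2.1.2
    by_cases hxA' : x ∈ A'
    · rw [← (hρW x hxA').2]
      exact (hρW x hxA').1.1.2.2.2
    · rw [hτ3 x hxA hxA', rngUnit_unit] at hx
      exact (hx rfl).elim

/-- A dense orbit stays dense after removing finitely many points, as no point is isolated. -/
theorem exists_arrow (hmin : IsMinimal G) [PerfectSpace (unitSpace G)]
    (x : unitSpace G) {B : Set (unitSpace G)} (hB : IsOpen B) (hBn : B.Nonempty)
    {F : Set (unitSpace G)} (hF : F.Finite) :
    ∃ g : G, srcUnit g = x ∧ rngUnit g ∈ B ∧ rngUnit g ∉ F := by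
  have : ∀ x : unitSpace G, (𝓝[≠] x).NeBot := perfectSpace_iff_forall_not_isolated.1 inferInstance
  obtain ⟨y, hy, ⟨g, hg, rfl⟩, hF⟩ := ((hmin x).sdiff_finite hF).inter_open_nonempty B hB hBn
  exact ⟨g, hg, hy, hF⟩

/-- An arrow with distinct source and range lies in an involution. An isotropy arrow `g` is factored
as `g k⁻¹` times `k`, where `k` leads from its base point to a different unit, and both factors are
of the first kind. -/
theorem exists_mem_fullGroup (hmin : IsMinimal G) [CompactSpace (unitSpace G)]
    [TotallyDisconnectedSpace (unitSpace G)] [PerfectSpace (unitSpace G)] (g : G) :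
    ∃ U : FullGroup G, g ∈ U.1 := by
  have key : ∀ g : G, srcUnit g ≠ rngUnit g → ∃ U : FullGroup G, g ∈ U.1 := fun g hg => by
    obtain ⟨U, -, h, -⟩ := exists_involution_mem g hg isOpen_univ (mem_univ _) (mem_univ _)
    exact ⟨U, h⟩
  by_cases hg : srcUnit g = rngUnit g
  · obtain ⟨k, hk, -, hkF⟩ := exists_arrow hmin (srcUnit g) isOpen_univ ⟨srcUnit g, mem_univ _⟩
      (finite_singleton (srcUnit g))
    rw [mem_singleton_iff] at hkF
    have hk' : src k = src g := congrArg Subtype.val hk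
    have hgk : src g = rng (inv k) := by rw [rng_inv, hk']
    have h1 : srcUnit (comp g (inv k)) = rngUnit k := Subtype.ext (by
      change src _ = rng k
      rw [src_comp _ _ hgk, src_inv])
    have h2 : rngUnit (comp g (inv k)) = srcUnit g := by
      rw [hg]
      exact Subtype.ext (rng_comp _ _ hgk)
    obtain ⟨U, hU⟩ := key (comp g (inv k)) (by rw [h1, h2]; exact hkF)
    obtain ⟨V, hV⟩ := key k (by rw [hk]; exact Ne.symm hkF)
    refine ⟨U * V, _, hU, k, hV, congrArg Subtype.val h1, ?_⟩
    rw [comp_assoc _ _ _ hgk (by simp), inv_comp, hk', comp_src]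
  · exact key g hg

theorem hasManyInvolutions (hmin : IsMinimal G) (heff : IsEffective G)
    [CompactSpace (unitSpace G)] [TotallyDisconnectedSpace (unitSpace G)]
    [PerfectSpace (unitSpace G)] : HasManyInvolutions (FullGroup G) (unitSpace G) where
  exists_involution x B hB hx := by
    obtain ⟨g, rfl, hgB, hgF⟩ := exists_arrow hmin x hB ⟨x, hx⟩ (finite_singleton x)
    obtain ⟨U, h1, h2, h3⟩ := exists_involution_mem g (Ne.symm hgF) hB hx hgB
    refine ⟨U, h1, ?_, h3⟩
    rw [mem_movedSet, ← rngUnit_sec', sec_srcUnit U h2]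
    exact hgF
  exists_mul_self_ne_one B hB hBn := by
    obtain ⟨x, hx⟩ := hBn
    obtain ⟨g, rfl, hgB, hgF⟩ := exists_arrow hmin x hB ⟨x, hx⟩ (finite_singleton x)
    obtain ⟨k, hkg, hkB, hkF⟩ := exists_arrow hmin (srcUnit g) hB ⟨_, hx⟩
      (toFinite {srcUnit g, rngUnit g})
    simp only [mem_insert_iff, mem_singleton_iff, not_or] at hgF hkF
    obtain ⟨U, hU1, hU2, hU3⟩ := exists_involution_mem g (Ne.symm hgF)
      (hB.inter (isClosed_singleton (x := rngUnit k)).isOpen_compl)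
      ⟨hx, Ne.symm hkF.1⟩ ⟨hgB, Ne.symm hkF.2⟩
    obtain ⟨V, hV1, hV2, hV3⟩ := exists_involution_mem k (by rw [hkg]; exact Ne.symm hkF.1)
      hB (by rwa [hkg]) hkB
    have e1 : U • srcUnit g = rngUnit g := by rw [← rngUnit_sec', sec_srcUnit U hU2]
    have e2 : V • srcUnit g = rngUnit k := by rw [← hkg, ← rngUnit_sec', sec_srcUnit V hV2]
    have e3 : U • rngUnit k = rngUnit k := notMem_movedSet.1 fun h => (hU3 h).2 rfl
    have e4 : V • rngUnit k = srcUnit g := by rw [← e2, ← mul_smul, hV1, one_smul]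
    -- `U` exchanges the first two of the points `srcUnit g`, `rngUnit g`, `rngUnit k` and fixes the
    -- third, while `V` exchanges the first and third. The square of the product thus sends `srcUnit
    -- g` to `rngUnit g`.
    refine ⟨U * V, fun h => hgF ?_, fun y hy => ?_⟩
    · have := congrArg (· • srcUnit g) h
      simpa only [mul_smul, e2, e3, e4, e1, one_smul] using this
    · by_contra hyB
      have h1 : V • y = y := notMem_movedSet.1 fun h => hyB (hV3 h)
      have h2 : U • y = y := notMem_movedSet.1 fun h => hyB (hU3 h).1
      exact hy (by rw [mul_smul, h1, h2])
  exists_restrict t ht A hA htA := exists_restrict t hA fun x => by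
    refine ⟨fun h => ?_, htA x⟩
    have := htA _ h
    rwa [← mul_smul, ht, one_smul] at this
  isOpen_closure_movedSet U := by
    rw [closure_movedSet_eq heff]
    exact (isClosed_sec_eq U).isOpen_compl

end ArrowGroupoid

/-! ### From homeomorphisms of units to automorphisms of arrows -/

namespace ArrowGroupoid

variable {G : Type u} [TopologicalSpace G] [ArrowGroupoid G] [IsEtale G] [T2Space G]

open FullGroup

/-- Agreement of arrows at `x` means that `x` is outside the closure of the set moved by `U⁻¹ * V`,
and `h` carries this closure to the one for `φ (U⁻¹ * V)`. This makes the extension to arrows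
independent of the chosen bisection. -/
theorem sec_apply_eq_of_sec_eq (heff : IsEffective G) {φ : MulAut (FullGroup G)}
    {h : unitSpace G ≃ₜ unitSpace G}
    (hh : ∀ (U : FullGroup G) (x : unitSpace G), h (U • x) = φ U • h x) {U V : FullGroup G}
    {x : unitSpace G} (e : U.sec x = V.sec x) : (φ U).sec (h x) = (φ V).sec (h x) := by
  rw [← sec_inv_mul_eq_iff, ← map_inv, ← map_mul]
  rw [← sec_inv_mul_eq_iff] at e
  by_contra hc
  have h1 : h x ∈ closure (movedSet (unitSpace G) (φ (U⁻¹ * V))) := by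
    rw [closure_movedSet_eq heff]
    exact hc
  have h2 : h ⁻¹' movedSet (unitSpace G) (φ (U⁻¹ * V)) = movedSet (unitSpace G) (U⁻¹ * V) := by
    ext y
    rw [mem_preimage, mem_movedSet, mem_movedSet, ← hh, h.injective.ne_iff]
  rw [← mem_preimage, h.preimage_closure, h2, closure_movedSet_eq heff] at h1
  exact h1 e

/-- A homeomorphism of the unit space that implements an automorphism of the full group extends
to the arrows. -/
theorem exists_extension (hmem : ∀ g : G, ∃ U : FullGroup G, g ∈ U.1) (heff : IsEffective G)
    {φ : MulAut (FullGroup G)} {h : unitSpace G ≃ₜ unitSpace G}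
    (hh : ∀ (U : FullGroup G) (x : unitSpace G), h (U • x) = φ U • h x) :
    ∃ f : G → G, Continuous f ∧
      ∀ (U : FullGroup G) (x : unitSpace G), f (U.sec x) = (φ U).sec (h x) := by
  choose u hu using hmem
  let f : G → G := fun g => (φ (u g)).sec (h (srcUnit g))
  have hf : ∀ (U : FullGroup G), ∀ g ∈ U.1, f g = (φ U).sec (h (srcUnit g)) := fun U g hg =>
    sec_apply_eq_of_sec_eq heff hh (by rw [sec_srcUnit _ (hu g), sec_srcUnit _ hg])
  refine ⟨f, continuous_iff_continuousAt.2 fun g => ?_, fun U x => ?_⟩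
  -- Near `g`, on the open set `u g`, a single bisection computes `f`.
  · refine (((φ (u g)).continuous_sec.comp
      (h.continuous.comp continuous_srcUnit)).continuousAt (x := g)).congr ?_
    filter_upwards [(u g).2.isClopen.2.mem_nhds (hu g)] with k hk using (hf _ k hk).symm
  · rw [hf U _ (U.sec_mem x), srcUnit_sec]

theorem exists_autFull_eq (hmem : ∀ g : G, ∃ U : FullGroup G, g ∈ U.1) (heff : IsEffective G)
    {φ : MulAut (FullGroup G)} {h : unitSpace G ≃ₜ unitSpace G}
    (hh : ∀ (U : FullGroup G) (x : unitSpace G), h (U • x) = φ U • h x) :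
    ∃ α : autGroup G, autFull G α = φ := by
  obtain ⟨f, hfc, hf⟩ := exists_extension hmem heff hh
  obtain ⟨k, hkc, hk⟩ := exists_extension hmem heff (φ := φ.symm) (h := h.symm) (fun U x => by
    rw [h.symm_apply_eq, hh, MulEquiv.apply_symm_apply, h.apply_symm_apply])
  have hsec : ∀ g : G, ∃ (U : FullGroup G) (x : unitSpace G), U.sec x = g := fun g => by
    obtain ⟨U, hU⟩ := hmem g
    exact ⟨U, _, sec_srcUnit U hU⟩
  have hunit : ∀ x : unitSpace G, f x = h x := fun x => by
    rw [← sec_one x, hf, map_one, sec_one]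
  refine ⟨⟨⟨⟨f, k, fun g => ?_, fun g => ?_⟩, hfc, hkc⟩, fun g => ?_, fun g => ?_,
    fun g g' e => ?_⟩, ?_⟩
  · obtain ⟨U, x, rfl⟩ := hsec g
    rw [hf, hk, MulEquiv.symm_apply_apply, h.symm_apply_apply]
  · obtain ⟨U, x, rfl⟩ := hsec g
    rw [hk, hf, MulEquiv.apply_symm_apply, h.apply_symm_apply]
  · obtain ⟨U, x, rfl⟩ := hsec g
    change f (src (U.sec x)) = src (f (U.sec x))
    rw [hf, src_sec, src_sec, hunit]
  · obtain ⟨U, x, rfl⟩ := hsec g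
    change f (rng (U.sec x)) = rng (f (U.sec x))
    rw [hf, rng_sec, rng_sec, hunit]
    exact congrArg Subtype.val (hh U x)
  · obtain ⟨U, x, rfl⟩ := hsec g
    obtain ⟨V, y, rfl⟩ := hsec g'
    have hx : x = V • y := by
      rw [← rngUnit_sec', ← srcUnit_sec U x]
      exact Subtype.ext e
    subst hx
    change f (comp (U.sec (V • y)) (V.sec y)) = comp (f (U.sec (V • y))) (f (V.sec y))
    rw [← sec_mul', hf, hf, hf, map_mul, sec_mul', hh]
  · refine MulEquiv.ext fun U => Subtype.ext ?_
    change f '' U.1 = (φ U).1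
    ext g
    constructor
    · rintro ⟨g, hg, rfl⟩
      rw [← sec_srcUnit U hg, hf]
      exact sec_mem _ _
    · intro hg
      exact ⟨U.sec (h.symm (srcUnit g)), U.sec_mem _, by
        rw [hf, h.apply_symm_apply, sec_srcUnit _ hg]⟩

theorem autFull_injective (hmem : ∀ g : G, ∃ U : FullGroup G, g ∈ U.1)
    (H : HasManyInvolutions (FullGroup G) (unitSpace G)) :
    Function.Injective (autFull G) := by
  rw [injective_iff_map_eq_one]
  intro α hα
  have hU : ∀ (U : FullGroup G), ∀ g ∈ U.1, α.1 g ∈ U.1 := fun U g hg => by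
    have := congrArg Subtype.val (DFunLike.congr_fun hα U)
    change α.1 '' U.1 = U.1 at this
    rw [← this]
    exact mem_image_of_mem _ hg
  have hs : ∀ g, srcUnit (α.1 g) = autUnit α (srcUnit g) := fun g =>
    Subtype.ext (aut_src α g).symm
  have hr : ∀ g, rngUnit (α.1 g) = autUnit α (rngUnit g) := fun g =>
    Subtype.ext (aut_rng α g).symm
  have hsec : ∀ (U : FullGroup G) (x : unitSpace G), α.1 (U.sec x) = U.sec (autUnit α x) :=
    fun U x => (sec_eq U (hU U _ (U.sec_mem x)) (by rw [hs, srcUnit_sec])).symm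
  -- Since `α` preserves each bisection, it intertwines the action of each bisection on units with
  -- itself.
  have hfix : ∀ x, autUnit α x = x := eq_self_of_equivariant H fun U x => by
    rw [← rngUnit_sec', ← hr, hsec, rngUnit_sec']
  refine Subtype.ext (Homeomorph.ext fun g => ?_)
  obtain ⟨U, hg⟩ := hmem g
  change α.1 g = g
  rw [← sec_srcUnit U hg, hsec, hfix]

/-- Needed for the passage to outer automorphism groups: it identifies the image of the inner
groupoid automorphisms with all inner automorphisms of the full group. Both `U V U⁻¹` and the image
of `V` under `Ad(U)` have, at `U • x`, the arrow `u v w⁻¹`, where `v` and `w` are the arrows of `V`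
and `U` at `x` and `u` is that of `U` at `V • x`. -/
theorem autFull_Ad (U : FullGroup G) : autFull G (Ad G U) = MulAut.conj U := by
  refine MulEquiv.ext fun V => ?_
  rw [MulAut.conj_apply, eq_mul_inv_iff_mul_eq]
  refine ext_sec fun x => ?_
  have h1 : adFun U (V.sec (U.unitHomeo.symm (U.unitHomeo x))) ∈ (autFull G (Ad G U) V).1 :=
    mem_image_of_mem _ (V.sec_mem _)
  rw [Homeomorph.symm_apply_apply] at h1
  have h2 : (autFull G (Ad G U) V).sec (U • x) = adFun U (V.sec x) :=
    sec_eq _ h1 (Subtype.ext ((src_adFun U _).trans (by rw [srcUnit_sec]; rfl)))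
  have c1 := adFun_aux' U (V.sec x)
  rw [sec_mul', sec_mul', h2, adFun, comp_assoc _ _ _ c1 (by rw [src_inv, srcUnit_sec]),
    srcUnit_sec, inv_comp, src_sec, rngUnit_sec']
  have := comp_src (comp (U.sec (V • x)) (V.sec x))
  rwa [show src (comp (U.sec (V • x)) (V.sec x)) = x from
    (src_comp _ _ (comp_sec U V x)).trans (src_sec V x)] at this

end ArrowGroupoid

/-! ### Automorphisms and outer automorphisms of the groupoid and of its full group -/

theorem proposition3p6 {G : Type u} [TopologicalSpace G] [ArrowGroupoid G]
    [SecondCountableTopology G] [LocallyCompactSpace G] [T2Space G] [IsAmple G]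
    (hmin : IsMinimal G) (heff : IsEffective G)
    (hCantor : Nonempty (unitSpace G ≃ₜ cantorSet)) :
    Function.Bijective (autFull G) ∧
      ∃ Φ : OutGroupoid G ≃* OutGroup (FullGroup G),
        ∀ α : autGroup G,
          Φ (QuotientGroup.mk α) = QuotientGroup.mk (autFull G α) := by
  obtain ⟨e⟩ := hCantor
  have : CompactSpace cantorSet := isCompact_iff_compactSpace.1 isCompact_cantorSet
  have : CompactSpace (unitSpace G) := e.symm.compactSpace
  have : TotallyDisconnectedSpace (unitSpace G) := IsAmple.totallyDisconnectedSpace_unitSpace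
  have : PerfectSpace (unitSpace G) := perfectSpace_iff_forall_not_isolated.2 fun x =>
    ⟨fun h => not_isOpen_singleton_of_homeomorph_cantorSet e x
      ((isOpen_singleton_iff_punctured_nhds x).2 h)⟩
  have := faithfulSMul_fullGroup heff
  have H := hasManyInvolutions hmin heff
  have hmem := exists_mem_fullGroup (G := G) hmin
  have hbij : Function.Bijective (autFull G) := by
    refine ⟨autFull_injective hmem H, fun φ => ?_⟩
    obtain ⟨h, hh⟩ := exists_equivariant_homeomorph H φ
    exact exists_autFull_eq hmem heff hh
  refine ⟨hbij, QuotientGroup.congr _ _ (MulEquiv.ofBijective (autFull G) hbij) ?_,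
    fun α => rfl⟩
  -- The isomorphism descends to the quotients once it carries one inner automorphism group onto the
  -- other.
  change (innGroup G).map (autFull G) = innerAutomorphisms (FullGroup G)
  have hcomp : (autFull G).comp (Ad G) = MulAut.conj := MonoidHom.ext autFull_Ad
  rw [innGroup, MonoidHom.map_range, hcomp, innerAutomorphisms]
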